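/- Let $(M,\mu)$ and $(N,\nu)$ be $\sigma$-finite measure spaces (for instance two oriented Riemannian manifolds with their volume measures), and let $X=M\times N$ carry the product measure $\mu\otimes\nu$ (for manifolds, this is the Riemannian volume of the product). Let $H$, $K$, $L$ be (possibly unbounded) self-adjoint operators on the complex spaces $L^2(M)$, $L^2(N)$ and $L^2(X)$, respectively. Assume that $L$ is the sum of $H$ and $K$ in the following sense: there are subsets $D_H$ of the domain of $H$ and $D_K$ of the domain of $K$, dense in these domains for the respective graph norms, such that for all $f\in D_H$ and $g\in D_K$ the function $f(x)g(y)$ belongs to the domain of $L$ and $$L\bigl(f(x)g(y)\bigr)=(Hf)(x)\,g(y)+f(x)\,(Kg)(y).$$ Let $a,b\ge 0$ be real, let $I\subseteq\mathbb{R}$ be an interval, let $1\le\widetilde r\le r\le\infty$, and suppose that there is a constant $C>0$ such that for all $t\in I$ $$\|e^{itH}\phi\|_{L^r(M)}\le C|t|^{-a}\|\phi\|_{L^{\widetilde r}(M)},\qquad \|e^{itK}\psi\|_{L^r(N)}\le C|t|^{-b}\|\psi\|_{L^{\widetilde r}(N)}$$ for all $\phi\in L^2(M)\cap L^{\widetilde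 r}(M)$ and all $\psi\in L^2(N)\cap L^{\widetilde r}(N)$. Then there is a constant $C'>0$ such that for all $t\in I$ and all $f\in L^2(X)\cap L^{\widetilde r}(X)$ $$\|e^{itL}f\|_{L^r(X)}\le C'|t|^{-a-b}\|f\|_{L^{\widetilde r}(X)}.$$ Here $e^{itH}$ denotes the strongly continuous unitary group with generator $iH$, and similarly for $K$ and $L$; at $t=0$ the factor $|t|^{-c}$ is read as $+\infty$ if $c>0$ (so the estimate is void) and as $1$ if $c=0$. -/

import Mathlib

open MeasureTheory Filter Topology
open scoped ENNReal NNReal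

section UnitaryGroup

variable {E : Type*} [NormedAddCommGroup E] [InnerProductSpace ℂ E]

/-- `U` is the strongly continuous one-parameter unitary group with generator `i T`: the difference
quotient `(U t f - f) / t` converges as `t → 0` exactly when `f` lies in the domain of `T`, and its
limit is then `i T f`. For self-adjoint `T` there is exactly one such `U`, see
`exists_isUnitaryGroupOf` and `IsUnitaryGroupOf.unique` below. -/
structure IsUnitaryGroupOf (T : E →ₗ.[ℂ] E) (U : ℝ → E →L[ℂ] E) : Prop where
  zero : U 0 = 1
  add : ∀ s t, U (s + t) = U s * U t
  norm_map : ∀ t f, ‖U t f‖ = ‖f‖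
  continuous : ∀ f, Continuous fun t => U t f
  generator : ∀ f g : E,
    Tendsto (fun t : ℝ => (t : ℂ)⁻¹ • (U t f - f)) (𝓝[≠] 0) (𝓝 g) ↔
      ∃ hf : f ∈ T.domain, g = Complex.I • T ⟨f, hf⟩

variable [CompleteSpace E] {T : E →ₗ.[ℂ] E}

theorem selfAdjoint_inner (hT : IsSelfAdjoint T) (f g : T.domain) :
    inner ℂ (T f) (g : E) = inner ℂ (f : E) (T g) := by
  have h := LinearPMap.adjoint_isFormalAdjoint hT.dense_domain
  rw [LinearPMap.isSelfAdjoint_def.1 hT] at h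
  exact h f g

theorem selfAdjoint_mem_domain (hT : IsSelfAdjoint T) {f w : E}
    (h : ∀ x : T.domain, inner ℂ w (x : E) = inner ℂ f (T x)) :
    ∃ hf : f ∈ T.domain, T ⟨f, hf⟩ = w := by
  have hf : f ∈ T.domain := by
    have := LinearPMap.mem_adjoint_domain_of_exists (T := T) f ⟨w, h⟩
    rwa [LinearPMap.isSelfAdjoint_def.1 hT] at this
  refine ⟨hf, hT.dense_domain.eq_of_inner_left ℂ fun v hv => ?_⟩
  rw [h ⟨v, hv⟩, selfAdjoint_inner hT ⟨f, hf⟩ ⟨v, hv⟩]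

theorem selfAdjoint_norm_sq (hT : IsSelfAdjoint T) (c : ℝ) (f : T.domain) :
    ‖T f + (Complex.I * c) • (f : E)‖ ^ 2 = ‖T f‖ ^ 2 + c ^ 2 * ‖(f : E)‖ ^ 2 := by
  have h1 : (inner ℂ (T f) (f : E) : ℂ).im = 0 := by
    have h2 := selfAdjoint_inner hT f f
    rw [← inner_conj_symm (f : E) (T f)] at h2
    exact Complex.conj_eq_iff_im.1 h2.symm
  rw [norm_add_sq (𝕜 := ℂ), inner_smul_right, norm_smul]
  simp [h1, mul_pow]

theorem selfAdjoint_resolvent (hT : IsSelfAdjoint T) {c : ℝ} (hc : c ≠ 0) :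
    ∃ R : E →L[ℂ] E,
      (∀ g, ∃ h : R g ∈ T.domain, T ⟨R g, h⟩ = g - (Complex.I * c) • R g) ∧
      (∀ f : T.domain, R (T f + (Complex.I * c) • (f : E)) = f) ∧
      ∀ g, ‖R g‖ ≤ |c|⁻¹ * ‖g‖ := by
  have hb : ∀ f : T.domain, ‖(f : E)‖ ≤ |c|⁻¹ * ‖T f + (Complex.I * c) • (f : E)‖ := by
    intro f
    have h := selfAdjoint_norm_sq hT c f
    rw [inv_mul_eq_div, le_div_iff₀ (abs_pos.2 hc)]
    refine abs_le_of_sq_le_sq' ?_ (norm_nonneg _) |>.2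
    rw [h, mul_pow, sq_abs]
    nlinarith [sq_nonneg ‖T f‖]
  have hb' : ∀ f : T.domain, ‖T f‖ ≤ ‖T f + (Complex.I * c) • (f : E)‖ := by
    intro f
    have h := selfAdjoint_norm_sq hT c f
    refine abs_le_of_sq_le_sq' ?_ (norm_nonneg _) |>.2
    rw [h]
    nlinarith [mul_nonneg (sq_nonneg c) (sq_nonneg ‖(f : E)‖)]
  let S : T.domain →ₗ[ℂ] E := T.toFun + (Complex.I * c) • T.domain.subtype
  have hS : ∀ f : T.domain, S f = T f + (Complex.I * c) • (f : E) := fun f => rfl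
  have hinj : Function.Injective S := by
    rw [← LinearMap.ker_eq_bot, LinearMap.ker_eq_bot']
    intro f hf
    have := hb f
    rw [← hS, hf] at this
    simpa using this
  have hclosed : _root_.IsClosed (LinearMap.range S : Set E) := by
    have : CompleteSpace T.graph := hT.isClosed.completeSpace_coe
    let Φ : T.graph →L[ℂ] E :=
      (ContinuousLinearMap.snd ℂ E E + (Complex.I * c) • ContinuousLinearMap.fst ℂ E E).comp
        T.graph.subtypeL
    have hΦ : AntilipschitzWith (max 1 (Real.toNNReal |c|⁻¹)) Φ := by
      refine AddMonoidHomClass.antilipschitz_of_bound Φ ?_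
      rintro ⟨⟨x, y⟩, hx⟩
      obtain ⟨f, rfl, rfl⟩ := (LinearPMap.mem_graph_iff T).1 hx
      change ‖((f : E), T f)‖ ≤ _ * ‖T f + (Complex.I * c) • (f : E)‖
      rw [Prod.norm_def]
      push_cast
      rw [Real.coe_toNNReal _ (by positivity)]
      refine max_le ((hb f).trans ?_) ((hb' f).trans ?_)
      · gcongr
        exact le_max_right _ _
      · exact le_mul_of_one_le_left (norm_nonneg _) (le_max_left _ _)
    have h := hΦ.isClosed_range Φ.uniformContinuous
    convert h using 1
    ext z
    constructor
    · rintro ⟨f, rfl⟩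
      exact ⟨⟨((f : E), T f), LinearPMap.mem_graph T f⟩, rfl⟩
    · rintro ⟨⟨⟨x, y⟩, hx⟩, rfl⟩
      obtain ⟨f, rfl, rfl⟩ := (LinearPMap.mem_graph_iff T).1 hx
      exact ⟨f, rfl⟩
  have hsurj : Function.Surjective S := by
    rw [← LinearMap.range_eq_top]
    have : CompleteSpace (LinearMap.range S) := hclosed.completeSpace_coe
    rw [← Submodule.orthogonal_eq_bot_iff, Submodule.eq_bot_iff]
    intro w hw
    rw [Submodule.mem_orthogonal'] at hw
    obtain ⟨hwd, hTw⟩ := selfAdjoint_mem_domain hT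
      (f := w) (w := (Complex.I * c) • w) fun x => by
        have := hw _ ⟨x, rfl⟩
        rw [hS, inner_add_right, inner_smul_right] at this
        rw [inner_smul_left, eq_neg_of_add_eq_zero_left this]
        simp
    have h := selfAdjoint_norm_sq hT (-c) ⟨w, hwd⟩
    rw [hTw] at h
    have h0 : (0 : ℝ) = ‖(Complex.I * c) • w‖ ^ 2 + (-c) ^ 2 * ‖w‖ ^ 2 := by
      rw [← h, Complex.ofReal_neg, mul_neg, neg_smul, add_neg_cancel]
      simp
    have h3 : c ^ 2 * ‖w‖ ^ 2 = 0 := by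
      have h4 : 0 ≤ c ^ 2 * ‖w‖ ^ 2 := by positivity
      nlinarith [sq_nonneg ‖(Complex.I * c) • w‖]
    have hc2 : c ^ 2 ≠ 0 := pow_ne_zero 2 hc
    simpa [hc] using h3
  let e := LinearEquiv.ofBijective S ⟨hinj, hsurj⟩
  have he : ∀ g, T (e.symm g) + (Complex.I * c) • (e.symm g : E) = g := fun g =>
    e.apply_symm_apply g
  refine ⟨(T.domain.subtype ∘ₗ e.symm.toLinearMap).mkContinuous |c|⁻¹ fun g => ?_,
    fun g => ⟨(e.symm g).2, ?_⟩, fun f => ?_, fun g => ?_⟩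
  · refine (hb (e.symm g)).trans_eq ?_
    rw [he]
  · exact eq_sub_of_add_eq (he g)
  · change ((e.symm (e f) : T.domain) : E) = f
    rw [e.symm_apply_apply]
  · refine (hb (e.symm g)).trans_eq ?_
    rw [he]

theorem selfAdjoint_approx (hT : IsSelfAdjoint T) :
    ∃ B : ℕ → E →L[ℂ] E, (∀ n, IsSelfAdjoint (B n)) ∧ (∀ m n, Commute (B m) (B n)) ∧
      (∀ n (f : T.domain), ‖B n f‖ ≤ ‖T f‖) ∧
      ∀ f : T.domain, Tendsto (fun n => B n f) atTop (𝓝 (T f)) := by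
  have hex : ∀ c : ℝ, ∃ R : E →L[ℂ] E, c ≠ 0 →
      (∀ g, ∃ h : R g ∈ T.domain, T ⟨R g, h⟩ = g - (Complex.I * c) • R g) ∧
      (∀ f : T.domain, R (T f + (Complex.I * c) • (f : E)) = f) ∧
      ∀ g, ‖R g‖ ≤ |c|⁻¹ * ‖g‖ := by
    intro c
    by_cases hc : c = 0
    · exact ⟨0, fun h => absurd hc h⟩
    · obtain ⟨R, hR⟩ := selfAdjoint_resolvent hT hc
      exact ⟨R, fun _ => hR⟩
  choose R hR using hex
  have hadj : ∀ c : ℝ, c ≠ 0 → star (R c) = R (-c) := by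
    intro c hc
    rw [ContinuousLinearMap.star_eq_adjoint]
    symm
    rw [ContinuousLinearMap.eq_adjoint_iff]
    intro g h
    obtain ⟨h1, h2⟩ := (hR c hc).1 h
    obtain ⟨h3, h4⟩ := (hR (-c) (neg_ne_zero.2 hc)).1 g
    have h5 := selfAdjoint_inner hT ⟨_, h3⟩ ⟨_, h1⟩
    rw [h2, h4] at h5
    simp only [inner_sub_left, inner_sub_right, inner_smul_left, inner_smul_right] at h5
    simp only [map_mul, map_neg, Complex.conj_I, Complex.conj_ofReal, Complex.ofReal_neg] at h5
    linear_combination -h5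
  have hres : ∀ c d : ℝ, c ≠ 0 → d ≠ 0 → ∀ g,
      R d g = R c g + (Complex.I * (c - d)) • R c (R d g) := by
    intro c d hc hd g
    obtain ⟨h1, h2⟩ := (hR d hd).1 g
    have h3 := (hR c hc).2.1 ⟨_, h1⟩
    rw [h2] at h3
    rw [← map_smul, ← map_add]
    refine h3.symm.trans (congrArg _ ?_)
    module
  have hcomm : ∀ c d : ℝ, c ≠ 0 → d ≠ 0 → Commute (R c) (R d) := by
    intro c d hc hd
    rcases eq_or_ne c d with rfl | hcd
    · exact Commute.refl _
    ext g
    have h1 := hres c d hc hd g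
    have h2 := hres d c hd hc g
    have h3 : (Complex.I * (c - d)) • (R c (R d g) - R d (R c g)) = 0 := by
      have h4 : R d g = (R d g + (Complex.I * (d - c)) • R d (R c g)) +
        (Complex.I * (c - d)) • R c (R d g) := by rw [← h2]; exact h1
      have h5 : (Complex.I * (c - d)) • (R c (R d g) - R d (R c g)) =
        ((R d g + (Complex.I * (d - c)) • R d (R c g)) +
        (Complex.I * (c - d)) • R c (R d g)) - R d g := by module
      rw [h5, ← h4, sub_self]
    rw [smul_eq_zero, sub_eq_zero (a := R c (R d g))] at h3
    rcases h3 with h3 | h3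
    · exfalso
      rw [← Complex.ofReal_sub] at h3
      simp [sub_eq_zero, hcd] at h3
    · exact h3
  let J : ℝ → E →L[ℂ] E := fun c => (Complex.I * c) • R c
  have hJ1 : ∀ c, c ≠ 0 → ∀ g, ‖J c g‖ ≤ ‖g‖ := by
    intro c hc g
    have h := (hR c hc).2.2 g
    change ‖(Complex.I * c) • R c g‖ ≤ _
    rw [norm_smul]
    have h2 : ‖Complex.I * (c : ℂ)‖ = |c| := by simp
    rw [h2]
    calc |c| * ‖R c g‖ ≤ |c| * (|c|⁻¹ * ‖g‖) := by gcongr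
      _ = ‖g‖ := by rw [← mul_assoc, mul_inv_cancel₀ (abs_ne_zero.2 hc), one_mul]
  have hJ2 : ∀ c, c ≠ 0 → ∀ f : T.domain, J c f - f = - R c (T f) := by
    intro c hc f
    have h := (hR c hc).2.1 f
    rw [map_add, map_smul] at h
    change (Complex.I * c) • R c f - (f : E) = _
    rw [sub_eq_iff_eq_add, neg_add_eq_sub, eq_sub_iff_add_eq, add_comm]
    exact h
  have hJ3 : ∀ c : ℕ → ℝ, (∀ n, c n ≠ 0) → Tendsto (fun n => |c n|⁻¹) atTop (𝓝 0) → ∀ g,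
      Tendsto (fun n => J (c n) g) atTop (𝓝 g) := by
    intro c hc hlim g
    rw [Metric.tendsto_atTop]
    intro ε hε
    obtain ⟨f, hf, hfg⟩ := Metric.mem_closure_iff.1 (hT.dense_domain g) (ε / 3) (by positivity)
    have h1 : Tendsto (fun n => |c n|⁻¹ * ‖T ⟨f, hf⟩‖) atTop (𝓝 0) := by
      simpa using hlim.mul_const ‖T ⟨f, hf⟩‖
    obtain ⟨N, hN⟩ := eventually_atTop.1 (h1.eventually (gt_mem_nhds (show 0 < ε / 3 by positivity)))
    refine ⟨N, fun n hn => ?_⟩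
    rw [dist_eq_norm] at hfg ⊢
    have h2 : J (c n) g - g = J (c n) (g - f) + (J (c n) f - f) - (g - f) := by
      rw [map_sub]; abel
    have h3 : ‖J (c n) f - f‖ ≤ |c n|⁻¹ * ‖T ⟨f, hf⟩‖ := by
      rw [hJ2 (c n) (hc n) ⟨f, hf⟩, norm_neg]
      exact (hR _ (hc n)).2.2 _
    calc ‖J (c n) g - g‖ ≤ ‖J (c n) (g - f)‖ + ‖J (c n) f - f‖ + ‖g - f‖ := by
          rw [h2]; exact (norm_sub_le _ _).trans (by gcongr; exact norm_add_le _ _)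
      _ ≤ ‖g - f‖ + |c n|⁻¹ * ‖T ⟨f, hf⟩‖ + ‖g - f‖ := by
          gcongr
          exact hJ1 _ (hc n) _
      _ < ε := by linarith [hN n hn]
  have hk : ∀ n : ℕ, (n : ℝ) + 1 ≠ 0 := fun n => by positivity
  have hk' : ∀ n : ℕ, -((n : ℝ) + 1) ≠ 0 := fun n => neg_ne_zero.2 (hk n)
  have hlim : Tendsto (fun n : ℕ => |(n : ℝ) + 1|⁻¹) atTop (𝓝 0) := by
    have := tendsto_one_div_add_atTop_nhds_zero_nat (𝕜 := ℝ)
    refine this.congr fun n => ?_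
    rw [abs_of_pos (by positivity), one_div]
  have hBf : ∀ (n : ℕ) (f : T.domain),
      ((((n : ℝ) + 1) ^ 2 / 2 : ℝ) : ℂ) • (R (n + 1) f + R (-(n + 1)) f) =
        (1 / 2 : ℂ) • (J (n + 1) (T f) + J (-(n + 1)) (T f)) := by
    intro n f
    have h1 : (Complex.I * ((n + 1 : ℝ) : ℂ)) • R (n + 1) f - (f : E) = - R (n + 1) (T f) :=
      hJ2 _ (hk n) f
    have h2 : (Complex.I * ((-(n + 1) : ℝ) : ℂ)) • R (-(n + 1)) f - (f : E) =
      - R (-(n + 1)) (T f) := hJ2 _ (hk' n) f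
    change _ = (1 / 2 : ℂ) • ((Complex.I * ((n + 1 : ℝ) : ℂ)) • R (n + 1) (T f) +
      (Complex.I * ((-(n + 1) : ℝ) : ℂ)) • R (-(n + 1)) (T f))
    rw [← neg_eq_iff_eq_neg.2 h1, ← neg_eq_iff_eq_neg.2 h2]
    generalize (n : ℝ) + 1 = c
    push_cast
    match_scalars <;> ring_nf <;> rw [Complex.I_sq] <;> ring
  refine ⟨fun n => ((((n : ℝ) + 1) ^ 2 / 2 : ℝ) : ℂ) • (R (n + 1) + R (-(n + 1))), ?_, ?_, ?_, ?_⟩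
  · intro n
    rw [isSelfAdjoint_iff, star_smul, star_add, hadj _ (hk n), hadj _ (hk' n), neg_neg,
      add_comm (R _)]
    congr 1
    exact Complex.conj_ofReal _
  · intro m n
    refine Commute.smul_left (Commute.smul_right ?_ _) _
    exact ((hcomm _ _ (hk _) (hk _)).add_right (hcomm _ _ (hk _) (hk' _))).add_left
      ((hcomm _ _ (hk' _) (hk _)).add_right (hcomm _ _ (hk' _) (hk' _)))
  · intro n f
    rw [smul_apply, add_apply, hBf, norm_smul]
    have h1 := hJ1 _ (hk n) (T f)
    have h2 := hJ1 _ (hk' n) (T f)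
    have h3 := norm_add_le (J (n + 1) (T f)) (J (-(n + 1)) (T f))
    have h4 : ‖(1 / 2 : ℂ)‖ = 1 / 2 := by simp
    rw [h4]
    linarith
  · intro f
    simp only [smul_apply, add_apply, hBf]
    have h1 := hJ3 (fun n => (n : ℝ) + 1) hk hlim (T f)
    have h2 := hJ3 (fun n => -((n : ℝ) + 1)) hk' (by simpa only [abs_neg] using hlim) (T f)
    have h3 := (h1.add h2).const_smul (1 / 2 : ℂ)
    convert h3 using 2
    module

/-- The exponential `exp (i t B)` of a bounded operator. -/
noncomputable def boundedGroup (B : E →L[ℂ] E) (t : ℝ) : E →L[ℂ] E :=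
  NormedSpace.exp ((Complex.I * t) • B)

theorem boundedGroup_norm {B : E →L[ℂ] E} (hB : IsSelfAdjoint B) (t : ℝ) (f : E) :
    ‖boundedGroup B t f‖ = ‖f‖ := by
  have h : (Complex.I * t) • B ∈ skewAdjoint (E →L[ℂ] E) := by
    rw [skewAdjoint.mem_iff, star_smul, hB.star_eq]
    simp
  let +nondep : NormedAlgebra ℚ (E →L[ℂ] E) := .restrictScalars ℚ ℂ _
  have h2 := NormedSpace.exp_mem_unitary_of_mem_skewAdjoint h
  exact ContinuousLinearMap.norm_map_of_mem_unitary h2 f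

theorem boundedGroup_add (B : E →L[ℂ] E) (s t : ℝ) :
    boundedGroup B (s + t) = boundedGroup B s * boundedGroup B t := by
  let +nondep : NormedAlgebra ℚ (E →L[ℂ] E) := .restrictScalars ℚ ℂ _
  rw [boundedGroup, boundedGroup, boundedGroup, ← NormedSpace.exp_add_of_commute]
  · congr 1
    push_cast
    module
  · exact ((Commute.refl B).smul_left _).smul_right _

theorem boundedGroup_sub {A B : E →L[ℂ] E} (h : Commute A B) (t : ℝ) :
    boundedGroup A t = boundedGroup B t * boundedGroup (A - B) t := by
  let +nondep : NormedAlgebra ℚ (E →L[ℂ] E) := .restrictScalars ℚ ℂ _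
  rw [boundedGroup, boundedGroup, boundedGroup, ← NormedSpace.exp_add_of_commute]
  · congr 1
    module
  · exact ((h.symm.sub_right (Commute.refl B)).smul_left _).smul_right _

theorem boundedGroup_zero (B : E →L[ℂ] E) : boundedGroup B 0 = 1 := by
  simp [boundedGroup]

theorem boundedGroup_hasDerivAt (B : E →L[ℂ] E) (f : E) (t : ℝ) :
    HasDerivAt (fun s => boundedGroup B s f) (boundedGroup B t (Complex.I • B f)) t := by
  have h1 := hasDerivAt_exp_smul_const (𝕂 := ℂ) B (Complex.I * t)
  have h2 : HasDerivAt (fun s : ℝ => Complex.I * (s : ℂ)) Complex.I t := by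
    simpa using (Complex.ofRealCLM.hasDerivAt (x := t)).const_mul Complex.I
  have h3 := h1.scomp t h2
  have h4 := (ContinuousLinearMap.apply ℂ E f).restrictScalars ℝ |>.hasFDerivAt.comp_hasDerivAt t h3
  refine h4.congr_deriv ?_
  change (Complex.I • (boundedGroup B t * B)) f = _
  rw [map_smul]
  rfl

theorem boundedGroup_continuous (B : E →L[ℂ] E) (f : E) :
    Continuous fun t => boundedGroup B t f :=
  continuous_iff_continuousAt.2 fun t => (boundedGroup_hasDerivAt B f t).continuousAt

theorem boundedGroup_sub_le {B : E →L[ℂ] E} (hB : IsSelfAdjoint B) (f : E) (t : ℝ) :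
    ‖boundedGroup B t f - f‖ ≤ |t| * ‖B f‖ := by
  have h := Convex.norm_image_sub_le_of_norm_hasDerivWithin_le (𝕜 := ℝ) (s := Set.univ)
    (f := fun s => boundedGroup B s f) (f' := fun s => boundedGroup B s (Complex.I • B f))
    (C := ‖B f‖) (x := 0) (y := t)
    (fun s _ => (boundedGroup_hasDerivAt B f s).hasDerivWithinAt)
    (fun s _ => by rw [boundedGroup_norm hB, norm_smul]; simp) convex_univ trivial trivial
  simpa [boundedGroup_zero, mul_comm] using h

theorem exists_isUnitaryGroupOf (hT : IsSelfAdjoint T) : ∃ U, IsUnitaryGroupOf T U := by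
  obtain ⟨B, hsa, hcomm, hle, hlim⟩ := selfAdjoint_approx hT
  have hcauchy : ∀ (t : ℝ) (f : E), CauchySeq fun n => boundedGroup (B n) t f := by
    intro t f
    rw [Metric.cauchySeq_iff]
    intro ε hε
    obtain ⟨g, hg, hfg⟩ := Metric.mem_closure_iff.1 (hT.dense_domain f) (ε / 3) (by positivity)
    have h1 : CauchySeq fun n => B n g := (hlim ⟨g, hg⟩).cauchySeq
    obtain ⟨N, hN⟩ := Metric.cauchySeq_iff.1 h1 (ε / (3 * (|t| + 1))) (by positivity)
    refine ⟨N, fun m hm n hn => ?_⟩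
    have h2 : ‖boundedGroup (B m) t g - boundedGroup (B n) t g‖ ≤ |t| * ‖B m g - B n g‖ := by
      have h : boundedGroup (B m) t g = boundedGroup (B n) t (boundedGroup (B m - B n) t g) := by
        rw [boundedGroup_sub (hcomm m n)]
        rfl
      rw [h, ← map_sub, boundedGroup_norm (hsa n)]
      exact boundedGroup_sub_le ((hsa m).sub (hsa n)) g t
    have h3 : |t| * ‖B m g - B n g‖ < ε / 3 := by
      have h4 := hN m hm n hn
      rw [dist_eq_norm, lt_div_iff₀ (by positivity)] at h4
      nlinarith [norm_nonneg (B m g - B n g)]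
    rw [dist_eq_norm] at hfg ⊢
    have h5 : boundedGroup (B m) t f - boundedGroup (B n) t f =
        boundedGroup (B m) t (f - g) + (boundedGroup (B m) t g - boundedGroup (B n) t g) -
          boundedGroup (B n) t (f - g) := by
      rw [map_sub, map_sub]; abel
    calc _ ≤ ‖boundedGroup (B m) t (f - g)‖ + ‖boundedGroup (B m) t g - boundedGroup (B n) t g‖ +
          ‖boundedGroup (B n) t (f - g)‖ := by
          rw [h5]; exact (norm_sub_le _ _).trans (by gcongr; exact norm_add_le _ _)
      _ < ε := by
          rw [boundedGroup_norm (hsa m), boundedGroup_norm (hsa n)]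
          linarith
  choose V hV using fun t f => cauchySeq_tendsto_of_complete (hcauchy t f)
  have hVnorm : ∀ t f, ‖V t f‖ = ‖f‖ := fun t f =>
    tendsto_nhds_unique (hV t f).norm (by simp [boundedGroup_norm (hsa _)])
  let U : ℝ → E →L[ℂ] E := fun t => LinearMap.mkContinuous
    { toFun := V t
      map_add' := fun f g => tendsto_nhds_unique (hV t (f + g)) (by
        simpa only [map_add] using (hV t f).add (hV t g))
      map_smul' := fun c f => tendsto_nhds_unique (hV t (c • f)) (by
        simpa only [map_smul, RingHom.id_apply] using (hV t f).const_smul c) } 1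
    fun f => by rw [one_mul]; exact (hVnorm t f).le
  have hU : ∀ t f, Tendsto (fun n => boundedGroup (B n) t f) atTop (𝓝 (U t f)) := hV
  have hUnorm : ∀ t f, ‖U t f‖ = ‖f‖ := hVnorm
  have hU0 : U 0 = 1 := by
    ext f
    refine tendsto_nhds_unique (hU 0 f) ?_
    simp only [boundedGroup_zero]
    exact tendsto_const_nhds
  have hUadd : ∀ s t, U (s + t) = U s * U t := by
    intro s t
    ext f
    refine tendsto_nhds_unique (hU (s + t) f) ?_
    have h1 : Tendsto (fun n => boundedGroup (B n) s (boundedGroup (B n) t f - U t f)) atTop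
        (𝓝 0) := by
      rw [tendsto_zero_iff_norm_tendsto_zero]
      simp only [boundedGroup_norm (hsa _)]
      exact tendsto_iff_norm_sub_tendsto_zero.1 (hU t f)
    have h2 := h1.add (hU s (U t f))
    simp only [map_sub, sub_add_cancel, zero_add] at h2
    refine h2.congr fun n => ?_
    rw [boundedGroup_add]
    rfl
  have hUcont0 : ∀ f, Tendsto (fun t => U t f) (𝓝 0) (𝓝 f) := by
    intro f
    rw [Metric.tendsto_nhds]
    intro ε hε
    obtain ⟨g, hg, hfg⟩ := Metric.mem_closure_iff.1 (hT.dense_domain f) (ε / 3) (by positivity)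
    have h1 : ∀ t, ‖U t g - g‖ ≤ |t| * ‖T ⟨g, hg⟩‖ := fun t =>
      le_of_tendsto ((hU t g).sub_const g).norm (Eventually.of_forall fun n =>
        (boundedGroup_sub_le (hsa n) g t).trans
          (mul_le_mul_of_nonneg_left (hle n ⟨g, hg⟩) (abs_nonneg t)))
    have h2 : Tendsto (fun t : ℝ => |t| * ‖T ⟨g, hg⟩‖) (𝓝 0) (𝓝 0) := by
      have : Continuous fun t : ℝ => |t| * ‖T ⟨g, hg⟩‖ := by fun_prop
      simpa using this.tendsto 0
    filter_upwards [h2.eventually (gt_mem_nhds (show 0 < ε / 3 by positivity))] with t ht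
    rw [dist_eq_norm] at hfg ⊢
    have h5 : U t f - f = U t (f - g) + (U t g - g) - (f - g) := by
      rw [map_sub]; abel
    calc _ ≤ ‖U t (f - g)‖ + ‖U t g - g‖ + ‖f - g‖ := by
          rw [h5]; exact (norm_sub_le _ _).trans (by gcongr; exact norm_add_le _ _)
      _ < ε := by
          rw [hUnorm]
          linarith [h1 t]
  have hUcont : ∀ f, Continuous fun t => U t f := by
    intro f
    rw [continuous_iff_continuousAt]
    intro t
    have h1 : Tendsto (fun s => U (s - t) f) (𝓝 t) (𝓝 f) := by
      refine (hUcont0 f).comp ?_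
      have : Continuous fun s : ℝ => s - t := by fun_prop
      simpa using this.tendsto t
    have h2 := ((U t).continuous.tendsto f).comp h1
    refine h2.congr fun s => ?_
    change (U t * U (s - t)) f = _
    rw [← hUadd, add_sub_cancel]
  have hderiv : ∀ f : T.domain, HasDerivAt (fun t => U t f) (Complex.I • T f) 0 := by
    intro f
    have h1 : ∀ t, U t f - f = ∫ s in (0 : ℝ)..t, U s (Complex.I • T f) := by
      intro t
      have h2 : ∀ n, ∫ s in (0 : ℝ)..t, boundedGroup (B n) s (Complex.I • B n f) =
          boundedGroup (B n) t f - f := by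
        intro n
        rw [intervalIntegral.integral_eq_sub_of_hasDerivAt
          (fun s _ => boundedGroup_hasDerivAt (B n) f s)
          ((boundedGroup_continuous _ _).intervalIntegrable _ _), boundedGroup_zero]
        rfl
      refine tendsto_nhds_unique ((hU t f).sub_const (f : E)) ?_
      simp only [← h2]
      refine intervalIntegral.tendsto_integral_filter_of_dominated_convergence
        (fun _ => ‖T f‖) ?_ ?_ (by simp) ?_
      · exact Eventually.of_forall fun n => (boundedGroup_continuous _ _).aestronglyMeasurable
      · refine Eventually.of_forall fun n => Eventually.of_forall fun s _ => ?_
        rw [boundedGroup_norm (hsa n), norm_smul, Complex.norm_I, one_mul]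
        exact hle n f
      · refine Eventually.of_forall fun s _ => ?_
        have h3 : Tendsto (fun n => boundedGroup (B n) s (Complex.I • B n f - Complex.I • T f))
            atTop (𝓝 0) := by
          rw [tendsto_zero_iff_norm_tendsto_zero]
          simp only [boundedGroup_norm (hsa _)]
          exact tendsto_iff_norm_sub_tendsto_zero.1 ((hlim f).const_smul Complex.I)
        have h4 := h3.add (hU s (Complex.I • T f))
        simpa only [map_sub, sub_add_cancel, zero_add] using h4
    have h5 := ((hUcont (Complex.I • T f)).integral_hasStrictDerivAt 0 0).hasDerivAt
    have h6 : (fun t => U t f) = fun t => (∫ s in (0 : ℝ)..t, U s (Complex.I • T f)) + f := by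
      funext t
      rw [← h1, sub_add_cancel]
    rw [h6]
    simpa [hU0] using h5.add_const (f : E)
  have hslope : ∀ f g : E, HasDerivAt (fun t => U t f) g 0 ↔
      Tendsto (fun t : ℝ => (t : ℂ)⁻¹ • (U t f - f)) (𝓝[≠] 0) (𝓝 g) := by
    intro f g
    rw [hasDerivAt_iff_tendsto_slope_zero]
    refine tendsto_congr fun t => ?_
    rw [zero_add, hU0, ← Complex.ofReal_inv, Complex.coe_smul]
    rfl
  refine ⟨U, hU0, hUadd, hUnorm, hUcont, fun f g => ⟨fun h => ?_, ?_⟩⟩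
  · rw [← hslope] at h
    have hd : ∀ x : T.domain, inner ℂ (-Complex.I • g) (x : E) = inner ℂ f (T x) := by
      intro x
      have h1 := h.inner ℂ (hderiv x)
      have h2 : (fun t => inner ℂ (U t f) (U t x)) = fun _ => inner ℂ f (x : E) := by
        funext t
        exact (LinearMap.norm_map_iff_inner_map_map (U t)).1 (hUnorm t) f x
      rw [h2] at h1
      have h3 := h1.unique (hasDerivAt_const _ _)
      rw [hU0] at h3
      simp only [one_apply_eq_self, inner_smul_right] at h3
      rw [inner_smul_left]
      simp only [map_neg, Complex.conj_I, neg_neg]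
      linear_combination (Complex.I) * h3 - (inner ℂ f (T x)) * Complex.I_mul_I
    obtain ⟨hf, hfg⟩ := selfAdjoint_mem_domain hT hd
    refine ⟨hf, ?_⟩
    rw [hfg, smul_smul, mul_neg, Complex.I_mul_I, neg_neg, one_smul]
  · rintro ⟨hf, rfl⟩
    rw [← hslope]
    exact hderiv ⟨f, hf⟩

theorem IsUnitaryGroupOf.apply_mem {U : ℝ → E →L[ℂ] E} (hU : IsUnitaryGroupOf T U) (t : ℝ)
    (f : T.domain) : ∃ h : U t f ∈ T.domain, T ⟨U t f, h⟩ = U t (T f) := by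
  have h1 := (hU.generator f _).2 ⟨f.2, rfl⟩
  have h2 := ((U t).continuous.tendsto _).comp h1
  have h3 : ((U t) ∘ fun s : ℝ => (s : ℂ)⁻¹ • (U s f - f)) =
      fun s : ℝ => (s : ℂ)⁻¹ • (U s (U t f) - U t f) := by
    funext s
    have h4 : U t (U s f) = U s (U t f) := by
      change (U t * U s) f = (U s * U t) f
      rw [← hU.add, ← hU.add, add_comm]
    simp only [Function.comp_apply, map_smul, map_sub, h4]
  rw [h3] at h2
  obtain ⟨h, h5⟩ := (hU.generator _ _).1 h2
  rw [map_smul] at h5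
  exact ⟨h, (smul_right_injective E Complex.I_ne_zero h5).symm⟩

theorem IsUnitaryGroupOf.hasDerivAt {U : ℝ → E →L[ℂ] E} (hU : IsUnitaryGroupOf T U) (t : ℝ)
    (f : T.domain) : HasDerivAt (fun s => U s f) (Complex.I • U t (T f)) t := by
  have h1 := (hU.generator f _).2 ⟨f.2, rfl⟩
  have h2 := ((U t).continuous.tendsto _).comp h1
  rw [hasDerivAt_iff_tendsto_slope_zero]
  rw [map_smul] at h2
  refine h2.congr fun s => ?_
  rw [hU.add, ← Complex.coe_smul, Complex.ofReal_inv]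
  simp only [Function.comp_apply, map_smul, map_sub]
  rfl

theorem IsUnitaryGroupOf.unique (hT : IsSelfAdjoint T) {U V : ℝ → E →L[ℂ] E}
    (hU : IsUnitaryGroupOf T U) (hV : IsUnitaryGroupOf T V) : U = V := by
  have hinner : ∀ t (f g : E), inner ℂ (U t f) (U t g) = inner ℂ f g := fun t =>
    (LinearMap.norm_map_iff_inner_map_map (U t)).1 (hU.norm_map t)
  have h1 : ∀ (t : ℝ) (f g : T.domain), inner ℂ (U t f) (V t g) = inner ℂ (f : E) (g : E) := by
    intro t f g
    have h2 : ∀ s, HasDerivAt (fun s => (inner ℂ (U s f) (V s g) : ℂ)) 0 s := by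
      intro s
      refine ((hU.hasDerivAt s f).inner ℂ (hV.hasDerivAt s g)).congr_deriv ?_
      obtain ⟨hf, hf'⟩ := hU.apply_mem s f
      obtain ⟨hg, hg'⟩ := hV.apply_mem s g
      have hs := selfAdjoint_inner hT ⟨_, hf⟩ ⟨_, hg⟩
      rw [hf', hg'] at hs
      rw [inner_smul_left, inner_smul_right, hs]
      simp
    have h3 := is_const_of_deriv_eq_zero (fun s => (h2 s).differentiableAt)
      (fun s => (h2 s).deriv) t 0
    simpa [hU.zero, hV.zero] using h3
  have h4 : ∀ (t : ℝ) (g : T.domain), U t g = V t g := by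
    intro t g
    have h5 : U (-t) (V t g) = g := by
      refine hT.dense_domain.eq_of_inner_right ℂ fun f hf => ?_
      rw [← h1 t ⟨f, hf⟩ g, ← hinner t]
      have : U t (U (-t) (V t g)) = V t g := by
        change (U t * U (-t)) _ = _
        rw [← hU.add, add_neg_cancel, hU.zero]
        rfl
      rw [this]
    conv_lhs => rw [← h5]
    change (U t * U (-t)) _ = _
    rw [← hU.add, add_neg_cancel, hU.zero]
    rfl
  funext t
  exact ContinuousLinearMap.coeFn_injective
    (Continuous.ext_on hT.dense_domain (U t).continuous (V t).continuous fun g hg => h4 t ⟨g, hg⟩)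

/-- The Schrödinger flow `t ↦ exp (i t T)` of a self-adjoint, possibly unbounded, operator `T`. -/
noncomputable def schrodingerGroup (T : E →ₗ.[ℂ] E) (hT : IsSelfAdjoint T) : ℝ → E →L[ℂ] E :=
  (exists_isUnitaryGroupOf hT).choose

theorem schrodingerGroup_spec (hT : IsSelfAdjoint T) :
    IsUnitaryGroupOf T (schrodingerGroup T hT) :=
  (exists_isUnitaryGroupOf hT).choose_spec

end UnitaryGroup

section ProductOperators

/-- `D` is dense in the domain of `T`, for the graph norm of `T`. -/
def GraphDense {E : Type*} [NormedAddCommGroup E] [NormedSpace ℂ E] (T : E →ₗ.[ℂ] E)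
    (D : Set T.domain) : Prop :=
  ∀ u : T.domain, ∀ ε > 0, ∃ f ∈ D, ‖(f : E) - u‖ < ε ∧ ‖T f - T u‖ < ε

variable {M N : Type*} [MeasurableSpace M] [MeasurableSpace N] {μ : Measure M} {ν : Measure N}

/-- `L` is the sum of `H` (acting on the first variable) and `K` (acting on the second one): for all
`f` and `g` in dense subsets of the domains of `H` and `K`, the function `f(x) g(y)` belongs to the
domain of `L`, and `L (f(x) g(y)) = (H f)(x) g(y) + f(x) (K g)(y)`. -/
def IsSumOperator (H : Lp ℂ 2 μ →ₗ.[ℂ] Lp ℂ 2 μ) (K : Lp ℂ 2 ν →ₗ.[ℂ] Lp ℂ 2 ν)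
    (L : Lp ℂ 2 (μ.prod ν) →ₗ.[ℂ] Lp ℂ 2 (μ.prod ν)) : Prop :=
  ∃ (D₁ : Set H.domain) (D₂ : Set K.domain), GraphDense H D₁ ∧ GraphDense K D₂ ∧
    ∀ f ∈ D₁, ∀ g ∈ D₂, ∃ F : L.domain,
      (F : Lp ℂ 2 (μ.prod ν)) =ᵐ[μ.prod ν]
        (fun z => (f : Lp ℂ 2 μ) z.1 * (g : Lp ℂ 2 ν) z.2) ∧
      L F =ᵐ[μ.prod ν]
        fun z => (H f) z.1 * (g : Lp ℂ 2 ν) z.2 + (f : Lp ℂ 2 μ) z.1 * (K g) z.2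

/-- The estimate `‖U t φ‖_{L^r} ≲ |t|^{-a} ‖φ‖_{L^p}` for all `t` in `I` and all `φ` in
`L^2 ∩ L^p`, with a constant independent of `t` and `φ`. The factor `|t|^{-a}` is computed in
`[0, ∞]`: at `t = 0` it is `∞` if `a > 0` (no condition) and `1` if `a = 0`. -/
def DispersiveEstimate (μ : Measure M) (U : ℝ → Lp ℂ 2 μ →L[ℂ] Lp ℂ 2 μ) (I : Set ℝ) (a : ℝ)
    (p r : ℝ≥0∞) : Prop :=
  ∃ C : ℝ≥0, 0 < C ∧ ∀ t ∈ I, ∀ φ : Lp ℂ 2 μ, MemLp φ p μ →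
    eLpNorm (U t φ) r μ ≤ C * ENNReal.ofReal |t| ^ (-a) * eLpNorm φ p μ

end ProductOperators

/-!
The group `e^{itL}` of the sum operator is the tensor product `e^{itH} ⊗ e^{itK}`: by closedness of
`L` the product rule `L (f ⊗ g) = H f ⊗ g + f ⊗ K g` extends from the dense subsets to all `f` and
`g` in the domains of `H` and `K`, so that `s ↦ e^{isH} f ⊗ e^{isK} g` solves the Schrödinger
equation of `L`, and its inner products with the orbits of `e^{isL}` are constant
(`IsSumOperator.group_tensorLp`).

For fixed `t` write `A = e^{itH}` and `B = e^{itK}`. As the functions `f(x) g(y)` span a dense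
subspace (`span_tensorLp_dense`), `A ⊗ B` is `B` acting in the second variable followed by `A` acting
in the first one: every square-integrable `φ` has a square-integrable `Φ` with
`Φ(x, ·) = B (φ(x, ·))` for almost every `x` and `(A ⊗ B) φ (·, y) = A (Φ(·, y))` for almost every
`y` (`exists_actsOnSnd_actsOnFst`). No approximation in the norm of `L^p` is needed, so `p = ∞` is
not exceptional.

If `A` and `B` map `L^p` to `L^r` with norms `c` and `d`, then
`‖(A ⊗ B) φ‖_r ≤ c ‖ ‖Φ(·, y)‖_{L^p(dx)} ‖_{L^r(dy)} ≤ c ‖ ‖Φ(x, ·)‖_{L^r(dy)} ‖_{L^p(dx)}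
  ≤ c d ‖φ‖_p`,
where the middle step is Minkowski's inequality and uses `p ≤ r` (`eLpNorm_eLpNorm_swap_le`). It is
proved here for measurable functions with values in `[0, ∞]`, as are Tonelli's theorem for `L^p`
seminorms and the measurability of the inner norms.
-/

/-! ### Mixed norms on a product -/

section MixedNorms

variable {M N : Type*} [MeasurableSpace M] [MeasurableSpace N] {μ : Measure M} {ν : Measure N}

theorem measurable_eLpNorm_slice [SFinite ν] {F : M × N → ℝ≥0∞} (hF : Measurable F) (p : ℝ≥0∞) :
    Measurable fun x => eLpNorm (fun y => F (x, y)) p ν := by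
  by_cases hp0 : p = 0
  · simp [hp0]
  by_cases hp : p = ∞
  · subst hp
    refine measurable_of_Iic fun c => ?_
    have h : (fun x => eLpNorm (fun y => F (x, y)) ∞ ν) ⁻¹' Set.Iic c =
        (fun x => ν (Prod.mk x ⁻¹' {z | c < F z})) ⁻¹' {0} := by
      ext x
      simp only [Set.mem_preimage, Set.mem_Iic, eLpNorm_exponent_top, eLpNormEssSup,
        enorm_eq_self, Set.mem_singleton_iff]
      rw [← not_iff_not]
      constructor
      · intro h h0
        refine h (essSup_le_of_ae_le c ?_)
        rw [EventuallyLE, ae_iff]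
        simpa using h0
      · intro h h0
        refine h ?_
        have h1 := ae_le_essSup (f := fun y => F (x, y)) (μ := ν)
        have h2 : ∀ᵐ y ∂ν, F (x, y) ≤ c := h1.mono fun y hy => hy.trans h0
        rw [ae_iff] at h2
        simpa using h2
    rw [h]
    exact measurable_measure_prodMk_left (measurableSet_lt measurable_const hF)
      (measurableSet_singleton 0)
  · simp only [eLpNorm_eq_lintegral_rpow_enorm_toReal hp0 hp, enorm_eq_self]
    exact (Measurable.lintegral_prod_right' (f := fun z => F z ^ p.toReal)
      (hF.pow_const _)).pow_const _

/-- Tonelli's theorem for `L^p` seminorms, including `p = ∞`. -/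
theorem eLpNorm_prod_eq [SFinite μ] [SFinite ν] {F : M × N → ℝ≥0∞} (hF : Measurable F)
    (p : ℝ≥0∞) :
    eLpNorm F p (μ.prod ν) = eLpNorm (fun x => eLpNorm (fun y => F (x, y)) p ν) p μ := by
  by_cases hp0 : p = 0
  · simp [hp0]
  by_cases hp : p = ∞
  · subst hp
    have hm := measurable_eLpNorm_slice (ν := ν) hF ∞
    simp only [eLpNorm_exponent_top, eLpNormEssSup, enorm_eq_self] at hm ⊢
    refine le_antisymm (essSup_le_of_ae_le _ ?_) (essSup_le_of_ae_le _ ?_)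
    · rw [EventuallyLE, Measure.ae_prod_iff_ae_ae (measurableSet_le hF measurable_const)]
      filter_upwards [ae_le_essSup (f := fun x => essSup (fun y => F (x, y)) ν) (μ := μ)] with x hx
      filter_upwards [ae_le_essSup (f := fun y => F (x, y)) (μ := ν)] with y hy
      exact hy.trans hx
    · filter_upwards [Measure.ae_ae_of_ae_prod (ae_le_essSup (f := F) (μ := μ.prod ν))] with x hx
      exact essSup_le_of_ae_le _ hx
  · have hp' : p.toReal ≠ 0 := ENNReal.toReal_ne_zero.2 ⟨hp0, hp⟩
    simp only [eLpNorm_eq_lintegral_rpow_enorm_toReal hp0 hp, enorm_eq_self]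
    rw [lintegral_prod _ (hF.pow_const _).aemeasurable]
    simp only [← ENNReal.rpow_mul, one_div, inv_mul_cancel₀ hp', ENNReal.rpow_one]

/-- The integral form of Minkowski's inequality. With `G y = ∫ F(x, y) dx`, Hölder's inequality
bounds `∫ g ^ p` by `K (∫ g ^ p) ^ (1 - 1 / p)` for every truncation `g ≤ G`, where `K` is the
right-hand side; the truncation makes `∫ g ^ p` finite, so that it may be cancelled. -/
theorem lintegral_lintegral_rpow_le [SFinite μ] [SigmaFinite ν] {F : M × N → ℝ≥0∞}
    (hF : Measurable F) {p : ℝ} (hp : 1 ≤ p) :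
    (∫⁻ y, (∫⁻ x, F (x, y) ∂μ) ^ p ∂ν) ^ (1 / p) ≤
      ∫⁻ x, (∫⁻ y, F (x, y) ^ p ∂ν) ^ (1 / p) ∂μ := by
  rcases hp.eq_or_lt with rfl | hp1
  · simp only [ENNReal.rpow_one, div_one]
    exact (lintegral_lintegral_swap (f := fun x y => F (x, y)) hF.aemeasurable).ge
  have hp0 : 0 < p := by linarith
  set q := p.conjExponent
  have hpq : p.HolderConjugate q := Real.HolderConjugate.conjExponent hp1
  set K := ∫⁻ x, (∫⁻ y, F (x, y) ^ p ∂ν) ^ (1 / p) ∂μ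
  set G : N → ℝ≥0∞ := fun y => ∫⁻ x, F (x, y) ∂μ
  have hG : Measurable G := hF.lintegral_prod_left'
  have key : ∀ g : N → ℝ≥0∞, Measurable g → g ≤ G → ∫⁻ y, g y ^ p ∂ν ≠ ∞ →
      ∫⁻ y, g y ^ p ∂ν ≤ K ^ p := by
    intro g hg hgG hfin
    set J := ∫⁻ y, g y ^ p ∂ν
    have hJ : J ≤ K * J ^ (1 / q) := by
      calc J ≤ ∫⁻ y, G y * g y ^ (p - 1) ∂ν := by
            refine lintegral_mono fun y => ?_
            have h : g y ^ p = g y * g y ^ (p - 1) := by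
              conv_rhs => enter [1]; rw [← ENNReal.rpow_one (g y)]
              rw [← ENNReal.rpow_add_of_nonneg _ _ zero_le_one (by linarith)]
              congr 1
              ring
            simp only [h]
            gcongr
            exact hgG y
        _ = ∫⁻ y, ∫⁻ x, F (x, y) * g y ^ (p - 1) ∂μ ∂ν := by
            refine lintegral_congr fun y => ?_
            rw [lintegral_mul_const _ (by fun_prop)]
        _ = ∫⁻ x, ∫⁻ y, F (x, y) * g y ^ (p - 1) ∂ν ∂μ :=
            (lintegral_lintegral_swap (f := fun x y => F (x, y) * g y ^ (p - 1))
              (by fun_prop)).symm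
        _ ≤ ∫⁻ x, (∫⁻ y, F (x, y) ^ p ∂ν) ^ (1 / p) * J ^ (1 / q) ∂μ := by
            refine lintegral_mono fun x => ?_
            refine (ENNReal.lintegral_mul_le_Lp_mul_Lq ν hpq (f := fun y => F (x, y))
              (g := fun y => g y ^ (p - 1)) (by fun_prop) (by fun_prop)).trans_eq ?_
            simp only [← ENNReal.rpow_mul, hpq.sub_one_mul_conj]
            rfl
        _ = K * J ^ (1 / q) := by
            rw [lintegral_mul_const]
            exact (Measurable.lintegral_prod_right' (f := fun z => F z ^ p)
              (hF.pow_const _)).pow_const _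
    rcases eq_or_ne J 0 with h0 | h0
    · rw [h0]; exact zero_le
    have h1 : J ^ (1 / p) ≤ K := by
      have h2 : J = J ^ (1 / p) * J ^ (1 / q) := by
        rw [← ENNReal.rpow_add _ _ h0 hfin, one_div, one_div, hpq.inv_add_inv_eq_one,
          ENNReal.rpow_one]
      have h3 : J ^ (1 / q) ≠ 0 := by
        simp [ENNReal.rpow_eq_zero_iff, h0, hfin]
      have h4 : J ^ (1 / q) ≠ ∞ := ENNReal.rpow_ne_top_of_nonneg (by
        have := hpq.symm.pos; positivity) hfin
      rw [← ENNReal.mul_le_mul_iff_left h3 h4, ← h2]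
      exact hJ
    calc J = (J ^ (1 / p)) ^ p := by
          rw [← ENNReal.rpow_mul, one_div, inv_mul_cancel₀ hp0.ne', ENNReal.rpow_one]
      _ ≤ K ^ p := by gcongr
  let g : ℕ → N → ℝ≥0∞ := fun n => (spanningSets ν n).indicator fun y => min (G y) n
  have hgm : ∀ n, Measurable (g n) := fun n =>
    (hG.min measurable_const).indicator (measurableSet_spanningSets ν n)
  have hglim : ∀ y, Tendsto (fun n => g n y ^ p) atTop (𝓝 (G y ^ p)) := by
    intro y
    refine ((ENNReal.continuous_rpow_const (y := p)).tendsto (G y)).comp ?_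
    have h1 : Tendsto (fun n : ℕ => min (G y) (n : ℝ≥0∞)) atTop (𝓝 (min (G y) ∞)) :=
      tendsto_const_nhds.min ENNReal.tendsto_nat_nhds_top
    rw [min_top_right] at h1
    refine h1.congr' ?_
    filter_upwards [eventually_mem_spanningSets ν y] with n hn
    exact (Set.indicator_of_mem hn (fun y => min (G y) (n : ℝ≥0∞))).symm
  have hgle : ∀ n, ∫⁻ y, g n y ^ p ∂ν ≤ K ^ p := by
    intro n
    refine key _ (hgm n) (Set.indicator_le fun y _ => min_le_left _ _) ?_
    · refine ne_top_of_le_ne_top (b := (n : ℝ≥0∞) ^ p * ν (spanningSets ν n)) ?_ ?_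
      · exact ENNReal.mul_ne_top (ENNReal.rpow_ne_top_of_nonneg hp0.le (ENNReal.natCast_ne_top n))
          (measure_spanningSets_lt_top ν n).ne
      · rw [← lintegral_indicator_const (measurableSet_spanningSets ν n)]
        refine lintegral_mono fun y => ?_
        by_cases hy : y ∈ spanningSets ν n
        · simp only [g, Set.indicator_of_mem hy]
          gcongr
          exact min_le_right _ _
        · simp [g, Set.indicator_of_notMem hy, hp0]
  have hfatou : ∫⁻ y, G y ^ p ∂ν ≤ K ^ p := by
    calc ∫⁻ y, G y ^ p ∂ν = ∫⁻ y, liminf (fun n => g n y ^ p) atTop ∂ν :=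
          lintegral_congr fun y => (hglim y).liminf_eq.symm
      _ ≤ liminf (fun n => ∫⁻ y, g n y ^ p ∂ν) atTop :=
          lintegral_liminf_le fun n => (hgm n).pow_const _
      _ ≤ K ^ p := liminf_le_of_frequently_le' (Frequently.of_forall hgle)
  calc (∫⁻ y, G y ^ p ∂ν) ^ (1 / p) ≤ (K ^ p) ^ (1 / p) := by gcongr
    _ = K := by rw [← ENNReal.rpow_mul, mul_one_div_cancel hp0.ne', ENNReal.rpow_one]

/-- Minkowski's inequality for mixed norms: the norm with the larger exponent is the larger one
when it is taken first. -/
theorem eLpNorm_eLpNorm_swap_le [SFinite μ] [SigmaFinite ν] {F : M × N → ℝ≥0∞}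
    (hF : Measurable F) {p q : ℝ≥0∞} (hp0 : p ≠ 0) (hpq : p ≤ q) :
    eLpNorm (fun y => eLpNorm (fun x => F (x, y)) p μ) q ν ≤
      eLpNorm (fun x => eLpNorm (fun y => F (x, y)) q ν) p μ := by
  by_cases hq : q = ∞
  · subst hq
    rw [eLpNorm_exponent_top]
    refine eLpNormEssSup_le_of_ae_enorm_bound ?_
    have h1 : ∀ᵐ z ∂μ.prod ν, F z ≤ eLpNorm (fun y => F (z.1, y)) ∞ ν := by
      have hm : Measurable fun z : M × N => eLpNorm (fun y => F (z.1, y)) ∞ ν :=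
        (measurable_eLpNorm_slice hF ∞).comp measurable_fst
      rw [Measure.ae_prod_iff_ae_ae (measurableSet_le hF hm)]
      refine Eventually.of_forall fun x => ?_
      simpa only [eLpNorm_exponent_top, eLpNormEssSup, enorm_eq_self] using
        ae_le_essSup (f := fun y => F (x, y)) (μ := ν)
    have h2 := Measure.measurePreserving_swap (μ := ν) (ν := μ)
      |>.quasiMeasurePreserving.ae h1
    filter_upwards [Measure.ae_ae_of_ae_prod h2] with y hy
    rw [enorm_eq_self]
    exact eLpNorm_mono_enorm_ae (by simpa using hy)
  have hp : p ≠ ∞ := ne_top_of_le_ne_top hq hpq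
  have hq0 : q ≠ 0 := fun h => hp0 (le_zero_iff.1 (h ▸ hpq))
  have hp' : 0 < p.toReal := ENNReal.toReal_pos hp0 hp
  have hq' : 0 < q.toReal := ENNReal.toReal_pos hq0 hq
  have hle : p.toReal ≤ q.toReal := ENNReal.toReal_mono hq hpq
  have h := lintegral_lintegral_rpow_le (μ := μ) (ν := ν) (hF.pow_const p.toReal)
    (p := q.toReal / p.toReal) ((one_le_div hp').2 hle)
  simp only [eLpNorm_eq_lintegral_rpow_enorm_toReal hp0 hp,
    eLpNorm_eq_lintegral_rpow_enorm_toReal hq0 hq, enorm_eq_self]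
  have h2 := ENNReal.rpow_le_rpow h (z := 1 / p.toReal) (by positivity)
  simp only [← ENNReal.rpow_mul] at h2 ⊢
  have e1 : p.toReal * (q.toReal / p.toReal) = q.toReal := by field_simp
  have e2 : 1 / (q.toReal / p.toReal) * (1 / p.toReal) = 1 / q.toReal := by field_simp
  have e3 : 1 / p.toReal * q.toReal = q.toReal / p.toReal := by field_simp
  have e4 : 1 / q.toReal * p.toReal = 1 / (q.toReal / p.toReal) := by field_simp
  rw [e3, e4]
  rwa [e1, e2] at h2

theorem eLpNorm_const_mul {F : M → ℝ≥0∞} (hF : Measurable F) {c p : ℝ≥0∞} :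
    eLpNorm (fun x => c * F x) p μ = c * eLpNorm F p μ := by
  by_cases hp0 : p = 0
  · simp [hp0]
  by_cases hp : p = ∞
  · subst hp
    simp only [eLpNorm_exponent_top, eLpNormEssSup, enorm_eq_self]
    exact ENNReal.essSup_const_mul
  · have hp' : 0 < p.toReal := ENNReal.toReal_pos hp0 hp
    simp only [eLpNorm_eq_lintegral_rpow_enorm_toReal hp0 hp, enorm_eq_self,
      ENNReal.mul_rpow_of_nonneg _ _ hp'.le]
    rw [lintegral_const_mul _ (hF.pow_const _), ENNReal.mul_rpow_of_nonneg _ _ (by positivity),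
      ← ENNReal.rpow_mul, mul_one_div_cancel hp'.ne', ENNReal.rpow_one]

end MixedNorms

/-! ### Operators acting on slices -/

section Slices

variable {M N : Type*} [MeasurableSpace M] [MeasurableSpace N] {μ : Measure M} {ν : Measure N}

theorem eLpNorm_prod_eq_slices [SFinite μ] [SFinite ν] {φ : M × N → ℂ} (hφ : Measurable φ)
    (p : ℝ≥0∞) :
    eLpNorm φ p (μ.prod ν) = eLpNorm (fun x => eLpNorm (fun y => φ (x, y)) p ν) p μ := by
  have h := eLpNorm_prod_eq (μ := μ) (ν := ν) hφ.enorm p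
  rw [eLpNorm_enorm] at h
  rw [h]
  simp only [eLpNorm_enorm (fun y => φ (_, y))]

theorem measurable_eLpNorm_slice_complex [SFinite ν] {φ : M × N → ℂ} (hφ : Measurable φ)
    (p : ℝ≥0∞) : Measurable fun x => eLpNorm (fun y => φ (x, y)) p ν := by
  have h := measurable_eLpNorm_slice (ν := ν) hφ.enorm p
  simpa only [eLpNorm_enorm (fun y => φ (_, y))] using h

theorem eLpNorm_two_sq {α : Type*} [MeasurableSpace α] (κ : Measure α) (f : α → ℂ) :
    eLpNorm f 2 κ ^ (2 : ℝ) = ∫⁻ x, ‖f x‖ₑ ^ (2 : ℝ) ∂κ :=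
  eLpNorm_nnreal_pow_eq_lintegral (p := 2) two_ne_zero

theorem eLpNorm_two_sq_prod [SFinite ν] {φ : M × N → ℂ} (hφ : Measurable φ) :
    eLpNorm φ 2 (μ.prod ν) ^ (2 : ℝ) = ∫⁻ x, eLpNorm (fun y => φ (x, y)) 2 ν ^ (2 : ℝ) ∂μ := by
  rw [eLpNorm_two_sq, lintegral_prod _ (hφ.enorm.pow_const _).aemeasurable]
  simp only [eLpNorm_two_sq]

theorem ae_memLp_slice [SFinite ν] {φ : M × N → ℂ} (hφ : Measurable φ)
    (h : eLpNorm φ 2 (μ.prod ν) ≠ ∞) : ∀ᵐ x ∂μ, MemLp (fun y => φ (x, y)) 2 ν := by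
  have h1 : ∫⁻ x, eLpNorm (fun y => φ (x, y)) 2 ν ^ (2 : ℝ) ∂μ ≠ ∞ := by
    rw [← eLpNorm_two_sq_prod hφ]
    exact ENNReal.rpow_ne_top_of_nonneg (by norm_num) h
  have hm := (measurable_eLpNorm_slice_complex (ν := ν) hφ 2).pow_const (2 : ℝ)
  filter_upwards [ae_lt_top hm h1] with x hx
  refine ⟨(hφ.comp measurable_prodMk_left).aestronglyMeasurable, ?_⟩
  rwa [ENNReal.rpow_lt_top_iff_of_pos (by norm_num)] at hx

/-- Geometric convergence to zero in `L^2` of a product implies convergence to zero in `L^2` of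
almost every slice. -/
theorem ae_tendsto_eLpNorm_slice [SFinite ν] {ψ : ℕ → M × N → ℂ} (hψ : ∀ n, Measurable (ψ n))
    (h : ∀ n, eLpNorm (ψ n) 2 (μ.prod ν) ≤ 2⁻¹ ^ n) :
    ∀ᵐ x ∂μ, Tendsto (fun n => eLpNorm (fun y => ψ n (x, y)) 2 ν) atTop (𝓝 0) := by
  have hm : ∀ n, Measurable fun x => eLpNorm (fun y => ψ n (x, y)) 2 ν ^ (2 : ℝ) :=
    fun n => (measurable_eLpNorm_slice_complex (hψ n) 2).pow_const _
  have h1 : ∫⁻ x, ∑' n, eLpNorm (fun y => ψ n (x, y)) 2 ν ^ (2 : ℝ) ∂μ ≠ ∞ := by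
    rw [lintegral_tsum fun n => (hm n).aemeasurable]
    refine ne_top_of_le_ne_top (b := ∑' n : ℕ, 2⁻¹ ^ n) ?_ (ENNReal.tsum_le_tsum fun n => ?_)
    · rw [ENNReal.tsum_geometric]
      simp
    · rw [← eLpNorm_two_sq_prod (hψ n)]
      have h2 : (2⁻¹ : ℝ≥0∞) ^ n ≤ 1 := pow_le_one' (by simp) n
      calc eLpNorm (ψ n) 2 (μ.prod ν) ^ (2 : ℝ) ≤ (2⁻¹ ^ n) ^ (2 : ℝ) := by gcongr; exact h n
        _ ≤ (2⁻¹ ^ n) ^ (1 : ℝ) := ENNReal.rpow_le_rpow_of_exponent_ge h2 (by norm_num)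
        _ = 2⁻¹ ^ n := ENNReal.rpow_one _
  filter_upwards [ae_lt_top (Measurable.tsum hm) h1] with x hx
  have h3 := ENNReal.tendsto_atTop_zero_of_tsum_ne_top hx.ne
  have h5 := ((ENNReal.continuous_rpow_const (y := (2 : ℝ)⁻¹)).tendsto 0).comp h3
  rw [ENNReal.zero_rpow_of_pos (by norm_num)] at h5
  refine h5.congr fun n => ?_
  simp only [Function.comp_apply, ← ENNReal.rpow_mul]
  norm_num

/-- `Φ` arises from `φ` by applying `B` in the second variable: almost every slice of `φ` lies in
`L^2`, and `B` maps it to the corresponding slice of `Φ`. This encodes `Φ = (1 ⊗ B) φ`. -/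
def ActsOnSlices (μ : Measure M) (B : Lp ℂ 2 ν →L[ℂ] Lp ℂ 2 ν) (φ Φ : M × N → ℂ) : Prop :=
  ∀ᵐ x ∂μ, ∃ u : Lp ℂ 2 ν, (fun y => φ (x, y)) =ᵐ[ν] u ∧ (fun y => Φ (x, y)) =ᵐ[ν] B u

variable {B : Lp ℂ 2 ν →L[ℂ] Lp ℂ 2 ν} {φ Φ ψ Ψ : M × N → ℂ}

theorem ActsOnSlices.congr [SFinite ν] (h : ActsOnSlices μ B φ Φ) (hφ : φ =ᵐ[μ.prod ν] ψ)
    (hΦ : Φ =ᵐ[μ.prod ν] Ψ) : ActsOnSlices μ B ψ Ψ := by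
  filter_upwards [h, Measure.ae_ae_of_ae_prod hφ, Measure.ae_ae_of_ae_prod hΦ]
  rintro x ⟨u, h1, h2⟩ h3 h4
  exact ⟨u, (EventuallyEq.symm h3).trans h1, (EventuallyEq.symm h4).trans h2⟩

theorem ActsOnSlices.zero : ActsOnSlices μ B 0 0 := by
  refine Eventually.of_forall fun x => ⟨0, ?_, ?_⟩
  · exact (Lp.coeFn_zero ℂ 2 ν).symm
  · rw [map_zero]
    exact (Lp.coeFn_zero ℂ 2 ν).symm

theorem ActsOnSlices.add (h : ActsOnSlices μ B φ Φ) (h' : ActsOnSlices μ B ψ Ψ) :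
    ActsOnSlices μ B (φ + ψ) (Φ + Ψ) := by
  filter_upwards [h, h']
  rintro x ⟨u, h1, h2⟩ ⟨v, h3, h4⟩
  refine ⟨u + v, (h1.add h3).trans (Lp.coeFn_add u v).symm, ?_⟩
  rw [map_add]
  exact (h2.add h4).trans (Lp.coeFn_add _ _).symm

theorem ActsOnSlices.smul (c : ℂ) (h : ActsOnSlices μ B φ Φ) :
    ActsOnSlices μ B (c • φ) (c • Φ) := by
  filter_upwards [h]
  rintro x ⟨u, h1, h2⟩
  refine ⟨c • u, (h1.const_smul c).trans (Lp.coeFn_smul c u).symm, ?_⟩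
  rw [map_smul]
  exact (h2.const_smul c).trans (Lp.coeFn_smul _ _).symm

theorem ActsOnSlices.tensor (f : M → ℂ) (g : Lp ℂ 2 ν) :
    ActsOnSlices μ B (fun z => f z.1 * g z.2) (fun z => f z.1 * B g z.2) := by
  refine Eventually.of_forall fun x => ⟨f x • g, ?_, ?_⟩
  · filter_upwards [Lp.coeFn_smul (f x) g] with y hy
    rw [hy, Pi.smul_apply, smul_eq_mul]
  · rw [map_smul]
    filter_upwards [Lp.coeFn_smul (f x) (B g)] with y hy
    rw [hy, Pi.smul_apply, smul_eq_mul]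

theorem ActsOnSlices.eLpNorm_eq [SFinite μ] [SFinite ν] (h : ActsOnSlices μ B φ Φ)
    (hB : ∀ u, ‖B u‖ = ‖u‖) (hφ : Measurable φ) (hΦ : Measurable Φ) :
    eLpNorm Φ 2 (μ.prod ν) = eLpNorm φ 2 (μ.prod ν) := by
  rw [eLpNorm_prod_eq_slices hφ, eLpNorm_prod_eq_slices hΦ]
  refine eLpNorm_congr_ae ?_
  filter_upwards [h]
  rintro x ⟨u, h1, h2⟩
  rw [eLpNorm_congr_ae h1, eLpNorm_congr_ae h2, ← Lp.enorm_def, ← Lp.enorm_def, ← ofReal_norm,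
    ← ofReal_norm, hB]

/-- A bound for `B` between Lebesgue spaces passes to almost every slice. -/
theorem ActsOnSlices.ae_eLpNorm_le (h : ActsOnSlices μ B φ Φ) {c p r : ℝ≥0∞}
    (hB : ∀ u : Lp ℂ 2 ν, eLpNorm (B u) r ν ≤ c * eLpNorm u p ν) :
    ∀ᵐ x ∂μ, eLpNorm (fun y => Φ (x, y)) r ν ≤ c * eLpNorm (fun y => φ (x, y)) p ν := by
  filter_upwards [h]
  rintro x ⟨u, h1, h2⟩
  rw [eLpNorm_congr_ae h1, eLpNorm_congr_ae h2]
  exact hB u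

/-- The graph of `1 ⊗ B` is closed in `L^2`. Geometric rates make almost every slice converge
without passing to subsequences. -/
theorem ActsOnSlices.of_limit [SFinite ν] {φs Φs : ℕ → M × N → ℂ}
    (h : ∀ n, ActsOnSlices μ B (φs n) (Φs n))
    (hφ : Measurable φ) (hΦ : Measurable Φ) (hφs : ∀ n, Measurable (φs n))
    (hΦs : ∀ n, Measurable (Φs n))
    (hφ2 : eLpNorm φ 2 (μ.prod ν) ≠ ∞) (hΦ2 : eLpNorm Φ 2 (μ.prod ν) ≠ ∞)
    (hlim : ∀ n, eLpNorm (φs n - φ) 2 (μ.prod ν) ≤ 2⁻¹ ^ n)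
    (hlim' : ∀ n, eLpNorm (Φs n - Φ) 2 (μ.prod ν) ≤ 2⁻¹ ^ n) : ActsOnSlices μ B φ Φ := by
  filter_upwards [ae_all_iff.2 h, ae_memLp_slice hφ hφ2, ae_memLp_slice hΦ hΦ2,
    ae_tendsto_eLpNorm_slice (fun n => (hφs n).sub hφ) hlim,
    ae_tendsto_eLpNorm_slice (fun n => (hΦs n).sub hΦ) hlim'] with x hx m1 m2 t1 t2
  choose u hu1 hu2 using hx
  have l1 : Tendsto u atTop (𝓝 (m1.toLp _)) := by
    rw [Lp.tendsto_Lp_iff_tendsto_eLpNorm']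
    refine t1.congr fun n => eLpNorm_congr_ae ?_
    exact (hu1 n).sub m1.coeFn_toLp.symm
  have l2 : Tendsto (fun n => B (u n)) atTop (𝓝 (m2.toLp _)) := by
    rw [Lp.tendsto_Lp_iff_tendsto_eLpNorm']
    refine t2.congr fun n => eLpNorm_congr_ae ?_
    exact (hu2 n).sub m2.coeFn_toLp.symm
  refine ⟨m1.toLp _, m1.coeFn_toLp.symm, ?_⟩
  rw [tendsto_nhds_unique ((B.continuous.tendsto _).comp l1) l2]
  exact m2.coeFn_toLp.symm

end Slices

/-! ### Tensor products of square-integrable functions -/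

section Tensor

variable {M N : Type*} [MeasurableSpace M] [MeasurableSpace N] {μ : Measure M} {ν : Measure N}

theorem eLpNorm_tensor [SFinite ν] (f : Lp ℂ 2 μ) (g : Lp ℂ 2 ν) :
    eLpNorm (fun z : M × N => f z.1 * g z.2) 2 (μ.prod ν) = eLpNorm f 2 μ * eLpNorm g 2 ν := by
  have hf := (Lp.stronglyMeasurable f).measurable
  have hg := (Lp.stronglyMeasurable g).measurable
  refine ENNReal.rpow_left_injective (x := 2) two_ne_zero ?_
  simp only [ENNReal.mul_rpow_of_nonneg _ _ (zero_le_two (α := ℝ)), eLpNorm_two_sq, enorm_mul]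
  exact lintegral_prod_mul (hf.enorm.pow_const _).aemeasurable (hg.enorm.pow_const _).aemeasurable

theorem memLp_tensor [SFinite ν] (f : Lp ℂ 2 μ) (g : Lp ℂ 2 ν) :
    MemLp (fun z : M × N => f z.1 * g z.2) 2 (μ.prod ν) := by
  refine ⟨?_, ?_⟩
  · exact (((Lp.stronglyMeasurable f).measurable.comp measurable_fst).mul
      ((Lp.stronglyMeasurable g).measurable.comp measurable_snd)).aestronglyMeasurable
  · rw [eLpNorm_tensor]
    exact ENNReal.mul_lt_top (Lp.eLpNorm_lt_top f) (Lp.eLpNorm_lt_top g)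

/-- The bounded bilinear map sending `f` and `g` to the class of `f(x) g(y)`. -/
noncomputable def tensorLp (μ : Measure M) (ν : Measure N) [SFinite μ] [SFinite ν] :
    Lp ℂ 2 μ →L[ℂ] Lp ℂ 2 ν →L[ℂ] Lp ℂ 2 (μ.prod ν) :=
  LinearMap.mkContinuous₂
    (LinearMap.mk₂ ℂ (fun f g => (memLp_tensor f g).toLp _)
      (by
        intro f f' g
        rw [← MemLp.toLp_add]
        refine MemLp.toLp_congr _ _ ?_
        filter_upwards [Measure.quasiMeasurePreserving_fst.ae (Lp.coeFn_add f f')] with z hz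
        simp only [hz, Pi.add_apply, add_mul])
      (by
        intro c f g
        rw [← MemLp.toLp_const_smul]
        refine MemLp.toLp_congr _ _ ?_
        filter_upwards [Measure.quasiMeasurePreserving_fst.ae (Lp.coeFn_smul c f)] with z hz
        simp only [hz, Pi.smul_apply, smul_eq_mul, mul_assoc])
      (by
        intro f g g'
        rw [← MemLp.toLp_add]
        refine MemLp.toLp_congr _ _ ?_
        filter_upwards [Measure.quasiMeasurePreserving_snd.ae (Lp.coeFn_add g g')] with z hz
        simp only [hz, Pi.add_apply, mul_add])
      (by
        intro c f g
        rw [← MemLp.toLp_const_smul]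
        refine MemLp.toLp_congr _ _ ?_
        filter_upwards [Measure.quasiMeasurePreserving_snd.ae (Lp.coeFn_smul c g)] with z hz
        simp only [hz, Pi.smul_apply, smul_eq_mul, mul_left_comm]))
    1 (by
      intro f g
      rw [LinearMap.mk₂_apply, Lp.norm_toLp, eLpNorm_tensor, ENNReal.toReal_mul, one_mul]
      rfl)

variable [SFinite μ] [SFinite ν]

theorem coeFn_tensorLp (f : Lp ℂ 2 μ) (g : Lp ℂ 2 ν) :
    tensorLp μ ν f g =ᵐ[μ.prod ν] fun z => f z.1 * g z.2 :=
  (memLp_tensor f g).coeFn_toLp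

theorem tensorLp_indicatorConstLp {s : Set M} {t : Set N} (hs : MeasurableSet s)
    (ht : MeasurableSet t) (hμs : μ s ≠ ∞) (hνt : ν t ≠ ∞)
    (hst : μ.prod ν (s ×ˢ t) ≠ ∞) :
    tensorLp μ ν (indicatorConstLp 2 hs hμs 1) (indicatorConstLp 2 ht hνt 1) =
      indicatorConstLp 2 (hs.prod ht) hst 1 := by
  refine Lp.ext ?_
  filter_upwards [coeFn_tensorLp (μ := μ) (ν := ν) (indicatorConstLp 2 hs hμs 1)
    (indicatorConstLp 2 ht hνt 1), indicatorConstLp_coeFn (p := 2) (hs := hs.prod ht)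
    (hμs := hst) (c := (1 : ℂ)),
    Measure.quasiMeasurePreserving_fst.ae (indicatorConstLp_coeFn (p := 2) (hs := hs)
      (hμs := hμs) (c := (1 : ℂ))),
    Measure.quasiMeasurePreserving_snd.ae (indicatorConstLp_coeFn (p := 2) (hs := ht)
      (hμs := hνt) (c := (1 : ℂ)))] with z h1 h2 h3 h4
  rw [h1, h2, h3, h4]
  by_cases hz1 : z.1 ∈ s <;> by_cases hz2 : z.2 ∈ t <;> simp [Set.indicator, hz1, hz2]

theorem tendsto_bilinear {E F G ι : Type*} [NormedAddCommGroup E] [NormedSpace ℂ E]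
    [NormedAddCommGroup F] [NormedSpace ℂ F] [NormedAddCommGroup G] [NormedSpace ℂ G]
    (T : E →L[ℂ] F →L[ℂ] G) {l : Filter ι} {u : ι → E} {v : ι → F} {f : E} {g : F}
    (hu : Tendsto u l (𝓝 f)) (hv : Tendsto v l (𝓝 g)) :
    Tendsto (fun i => T (u i) (v i)) l (𝓝 (T f g)) :=
  (T.continuous₂.tendsto (f, g)).comp (hu.prodMk_nhds hv)

theorem continuous_tensorLp :
    Continuous fun p : Lp ℂ 2 μ × Lp ℂ 2 ν => tensorLp μ ν p.1 p.2 :=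
  (tensorLp μ ν).continuous₂

end Tensor

section TensorDense

variable {M N : Type*} [MeasurableSpace M] [MeasurableSpace N] {μ : Measure M} {ν : Measure N}
  [SigmaFinite μ] [SigmaFinite ν]

/-- A square-integrable function orthogonal to all `f(x) g(y)` has integral zero over all
rectangles of finite measure, hence over all measurable subsets of such rectangles. -/
theorem eq_zero_of_inner_tensorLp (h : Lp ℂ 2 (μ.prod ν))
    (hh : ∀ f g, inner ℂ (tensorLp μ ν f g) h = 0) : h = 0 := by
  have hrect : ∀ s t, MeasurableSet s → MeasurableSet t → μ s ≠ ∞ → ν t ≠ ∞ →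
      ∫ z in s ×ˢ t, h z ∂μ.prod ν = 0 := by
    intro s t hs ht hμs hνt
    have hst : μ.prod ν (s ×ˢ t) ≠ ∞ := by
      rw [Measure.prod_prod]
      exact ENNReal.mul_ne_top hμs hνt
    rw [← L2.inner_indicatorConstLp_one (hs.prod ht) hst h,
      ← tensorLp_indicatorConstLp hs ht hμs hνt hst]
    exact hh _ _
  have hbox : ∀ i j, ∀ᵐ z ∂(μ.prod ν).restrict (spanningSets μ i ×ˢ spanningSets ν j),
      h z = 0 := by
    intro i j
    set S := spanningSets μ i
    set T := spanningSets ν j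
    have hS : MeasurableSet S := measurableSet_spanningSets μ i
    have hT : MeasurableSet T := measurableSet_spanningSets ν j
    have hμS : μ S ≠ ∞ := (measure_spanningSets_lt_top μ i).ne
    have hνT : ν T ≠ ∞ := (measure_spanningSets_lt_top ν j).ne
    have hST : μ.prod ν (S ×ˢ T) ≠ ∞ := by
      rw [Measure.prod_prod]
      exact ENNReal.mul_ne_top hμS hνT
    have hint : IntegrableOn h (S ×ˢ T) (μ.prod ν) :=
      integrableOn_Lp_of_measure_ne_top h fact_one_le_two_ennreal.elim hST
    refine Integrable.ae_eq_zero_of_forall_setIntegral_eq_zero hint fun s hs _ => ?_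
    clear * - hs hrect hS hT hμS hνT hint
    induction s, hs
      using MeasurableSpace.induction_on_inter generateFrom_prod.symm isPiSystem_prod with
    | empty => simp
    | basic s hs =>
      obtain ⟨s, hs, t, ht, rfl⟩ := hs
      simp only [Set.mem_ofPred_eq] at hs ht
      rw [Measure.restrict_restrict (hs.prod ht), Set.prod_inter_prod]
      exact hrect _ _ (hs.inter hS) (ht.inter hT)
        (measure_ne_top_of_subset Set.inter_subset_right hμS)
        (measure_ne_top_of_subset Set.inter_subset_right hνT)
    | compl s hs ihs =>
      rw [setIntegral_compl hs hint, ihs, sub_zero]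
      exact hrect S T hS hT hμS hνT
    | iUnion f hfd hfm ihf =>
      rw [integral_iUnion hfm hfd hint.integrableOn]
      simp [ihf]
  have hall : ∀ᵐ z ∂μ.prod ν, h z = 0 := by
    have hU : (⋃ p : ℕ × ℕ, spanningSets μ p.1 ×ˢ spanningSets ν p.2) = Set.univ := by
      refine Set.eq_univ_of_forall fun z => Set.mem_iUnion.2
        ⟨(spanningSetsIndex μ z.1, spanningSetsIndex ν z.2), ?_, ?_⟩
      · exact mem_spanningSetsIndex μ z.1
      · exact mem_spanningSetsIndex ν z.2
    have h1 := (ae_restrict_iUnion_iff (μ := μ.prod ν)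
      (fun p : ℕ × ℕ => spanningSets μ p.1 ×ˢ spanningSets ν p.2) (fun z => h z = 0)).2
      fun p => hbox p.1 p.2
    rwa [hU, Measure.restrict_univ] at h1
  exact (Lp.eq_zero_iff_ae_eq_zero).2 hall

theorem span_tensorLp_dense :
    (Submodule.span ℂ (Set.range fun p : Lp ℂ 2 μ × Lp ℂ 2 ν =>
      tensorLp μ ν p.1 p.2)).topologicalClosure = ⊤ := by
  rw [Submodule.topologicalClosure_eq_top_iff, Submodule.eq_bot_iff]
  intro h hh
  refine eq_zero_of_inner_tensorLp h fun f g => ?_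
  exact (Submodule.mem_orthogonal _ _).1 hh _ (Submodule.subset_span ⟨(f, g), rfl⟩)

end TensorDense

/-! ### The group of a sum operator -/

section SumOperator

variable {M N : Type*} [MeasurableSpace M] [MeasurableSpace N] {μ : Measure M} {ν : Measure N}

theorem GraphDense.exists_seq {E : Type*} [NormedAddCommGroup E] [NormedSpace ℂ E]
    {T : E →ₗ.[ℂ] E} {D : Set T.domain} (hD : GraphDense T D) (u : T.domain) :
    ∃ f : ℕ → T.domain, (∀ n, f n ∈ D) ∧ Tendsto (fun n => (f n : E)) atTop (𝓝 u) ∧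
      Tendsto (fun n => T (f n)) atTop (𝓝 (T u)) := by
  choose f hf h1 h2 using fun n : ℕ => hD u (1 / ((n : ℝ) + 1)) (by positivity)
  refine ⟨f, hf, ?_, ?_⟩
  · exact tendsto_iff_norm_sub_tendsto_zero.2 (squeeze_zero (fun _ => norm_nonneg _)
      (fun n => (h1 n).le) tendsto_one_div_add_atTop_nhds_zero_nat)
  · exact tendsto_iff_norm_sub_tendsto_zero.2 (squeeze_zero (fun _ => norm_nonneg _)
      (fun n => (h2 n).le) tendsto_one_div_add_atTop_nhds_zero_nat)

variable [SFinite μ] [SFinite ν]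
  {H : Lp ℂ 2 μ →ₗ.[ℂ] Lp ℂ 2 μ} {K : Lp ℂ 2 ν →ₗ.[ℂ] Lp ℂ 2 ν}
  {L : Lp ℂ 2 (μ.prod ν) →ₗ.[ℂ] Lp ℂ 2 (μ.prod ν)}

/-- As `L` is closed, the formula `L (f ⊗ g) = H f ⊗ g + f ⊗ K g` extends from the dense subsets to
the whole domains of `H` and `K`. -/
theorem IsSumOperator.apply_tensorLp (hsum : IsSumOperator H K L) (hL : L.IsClosed)
    (f : H.domain) (g : K.domain) :
    ∃ h : tensorLp μ ν f g ∈ L.domain,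
      L ⟨tensorLp μ ν f g, h⟩ = tensorLp μ ν (H f) g + tensorLp μ ν f (K g) := by
  obtain ⟨D₁, D₂, hD₁, hD₂, hD⟩ := hsum
  obtain ⟨fs, hfs, hf1, hf2⟩ := hD₁.exists_seq f
  obtain ⟨gs, hgs, hg1, hg2⟩ := hD₂.exists_seq g
  have hmem : (tensorLp μ ν f g, tensorLp μ ν (H f) g + tensorLp μ ν f (K g)) ∈
      (L.graph : Set _) := by
    refine _root_.IsClosed.mem_of_tendsto hL ((tendsto_bilinear _ hf1 hg1).prodMk_nhds
      ((tendsto_bilinear _ hf2 hg1).add (tendsto_bilinear _ hf1 hg2)))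
      (Eventually.of_forall fun n => ?_)
    obtain ⟨F, hF1, hF2⟩ := hD _ (hfs n) _ (hgs n)
    refine (LinearPMap.mem_graph_iff L).2 ⟨F, ?_, ?_⟩
    · exact Lp.ext (hF1.trans (coeFn_tensorLp _ _).symm)
    · refine Lp.ext ?_
      filter_upwards [hF2, coeFn_tensorLp (H (fs n)) (gs n : Lp ℂ 2 ν),
        coeFn_tensorLp (fs n : Lp ℂ 2 μ) (K (gs n)),
        Lp.coeFn_add (tensorLp μ ν (H (fs n)) (gs n)) (tensorLp μ ν (fs n) (K (gs n)))]
        with z h1 h2 h3 h4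
      rw [h1, h4, Pi.add_apply, h2, h3]
  obtain ⟨F, hF1, hF2⟩ := (LinearPMap.mem_graph_iff L).1 hmem
  change (F : Lp ℂ 2 (μ.prod ν)) = tensorLp μ ν f g at hF1
  change L F = tensorLp μ ν (H f) g + tensorLp μ ν f (K g) at hF2
  have h : tensorLp μ ν f g ∈ L.domain := hF1 ▸ F.2
  refine ⟨h, ?_⟩
  rw [← hF2]
  congr 1
  exact Subtype.ext hF1.symm

variable {U : ℝ → Lp ℂ 2 μ →L[ℂ] Lp ℂ 2 μ} {V : ℝ → Lp ℂ 2 ν →L[ℂ] Lp ℂ 2 ν}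
  {W : ℝ → Lp ℂ 2 (μ.prod ν) →L[ℂ] Lp ℂ 2 (μ.prod ν)}

theorem IsUnitaryGroupOf.inner_map_map {E : Type*} [NormedAddCommGroup E] [InnerProductSpace ℂ E]
    {T : E →ₗ.[ℂ] E} {U : ℝ → E →L[ℂ] E} (hU : IsUnitaryGroupOf T U) (t : ℝ) (f g : E) :
    inner ℂ (U t f) (U t g) = inner ℂ f g :=
  (LinearMap.norm_map_iff_inner_map_map (U t)).1 (hU.norm_map t) f g

/-- On the domains, `s ↦ ⟪W s F, U s f ⊗ V s g⟫` has derivative zero for all `F` in the domain of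
`L`, by symmetry of `L`; as this domain is dense, `W (-t)` maps `U t f ⊗ V t g` to `f ⊗ g`. -/
theorem IsSumOperator.group_tensorLp_of_mem (hsum : IsSumOperator H K L) (hL : IsSelfAdjoint L)
    (hU : IsUnitaryGroupOf H U) (hV : IsUnitaryGroupOf K V) (hW : IsUnitaryGroupOf L W) (t : ℝ)
    (f : H.domain) (g : K.domain) :
    W t (tensorLp μ ν f g) = tensorLp μ ν (U t f) (V t g) := by
  have h1 : ∀ F : L.domain, inner ℂ (W t F) (tensorLp μ ν (U t f) (V t g)) =
      inner ℂ (F : Lp ℂ 2 (μ.prod ν)) (tensorLp μ ν f g) := by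
    intro F
    have h2 : ∀ s, HasDerivAt
        (fun s => (inner ℂ (W s F) (tensorLp μ ν (U s f) (V s g)) : ℂ)) 0 s := by
      intro s
      have hd : HasDerivAt (fun s => tensorLp μ ν (U s f) (V s g))
          (tensorLp μ ν (U s f) (Complex.I • V s (K g)) +
            tensorLp μ ν (Complex.I • U s (H f)) (V s g)) s :=
        ((tensorLp μ ν).bilinearRestrictScalars ℝ).hasDerivAt_of_bilinear
          (fun _ => hU.hasDerivAt s f) (fun _ => hV.hasDerivAt s g)
      refine ((hW.hasDerivAt s F).inner ℂ hd).congr_deriv ?_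
      obtain ⟨hf, hf'⟩ := hU.apply_mem s f
      obtain ⟨hg, hg'⟩ := hV.apply_mem s g
      obtain ⟨hF, hF'⟩ := hW.apply_mem s F
      obtain ⟨hT, hT'⟩ := hsum.apply_tensorLp hL.isClosed ⟨_, hf⟩ ⟨_, hg⟩
      have hs := selfAdjoint_inner hL ⟨_, hF⟩ ⟨_, hT⟩
      rw [hF', hT', hf', hg'] at hs
      simp only [map_smul, smul_apply, inner_add_right, inner_smul_left,
        inner_smul_right, Complex.conj_I] at hs ⊢
      rw [hs]
      ring
    have h3 := is_const_of_deriv_eq_zero (fun s => (h2 s).differentiableAt)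
      (fun s => (h2 s).deriv) t 0
    simpa [hU.zero, hV.zero, hW.zero] using h3
  have hinv : ∀ F, W t (W (-t) F) = F := by
    intro F
    change (W t * W (-t)) F = F
    rw [← hW.add, add_neg_cancel, hW.zero]
    rfl
  have h5 : W (-t) (tensorLp μ ν (U t f) (V t g)) = tensorLp μ ν f g := by
    refine hL.dense_domain.eq_of_inner_right ℂ fun F hF => ?_
    rw [← h1 ⟨F, hF⟩, ← hW.inner_map_map t, hinv]
  rw [← h5, hinv]

/-- The group of a sum operator acts as the tensor product of the groups of the summands. -/
theorem IsSumOperator.group_tensorLp (hsum : IsSumOperator H K L) (hH : IsSelfAdjoint H)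
    (hK : IsSelfAdjoint K) (hL : IsSelfAdjoint L)
    (hU : IsUnitaryGroupOf H U) (hV : IsUnitaryGroupOf K V) (hW : IsUnitaryGroupOf L W) (t : ℝ)
    (f : Lp ℂ 2 μ) (g : Lp ℂ 2 ν) :
    W t (tensorLp μ ν f g) = tensorLp μ ν (U t f) (V t g) := by
  have hd : Dense ((H.domain : Set (Lp ℂ 2 μ)) ×ˢ (K.domain : Set (Lp ℂ 2 ν))) :=
    Dense.prod hH.dense_domain hK.dense_domain
  refine congrFun (Continuous.ext_on hd
    (f := fun p : Lp ℂ 2 μ × Lp ℂ 2 ν => W t (tensorLp μ ν p.1 p.2))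
    (g := fun p => tensorLp μ ν (U t p.1) (V t p.2)) ((W t).continuous.comp continuous_tensorLp)
    (continuous_tensorLp.comp (((U t).continuous.comp continuous_fst).prodMk
      ((V t).continuous.comp continuous_snd))) ?_) (f, g)
  rintro ⟨f, g⟩ ⟨hf, hg⟩
  exact hsum.group_tensorLp_of_mem hL hU hV hW t ⟨f, hf⟩ ⟨g, hg⟩

end SumOperator

/-! ### Factoring a tensor product of isometries -/

section Factorization

variable {M N : Type*} [MeasurableSpace M] [MeasurableSpace N] {μ : Measure M} {ν : Measure N}

/-- `ActsOnSlices` for classes of functions on the product, with the operator acting in the second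
variable. -/
def ActsOnSnd (B : Lp ℂ 2 ν →L[ℂ] Lp ℂ 2 ν) (φ Φ : Lp ℂ 2 (μ.prod ν)) : Prop :=
  ActsOnSlices μ B φ Φ

/-- `ActsOnSlices` for classes of functions on the product, with the operator acting in the first
variable. -/
def ActsOnFst (A : Lp ℂ 2 μ →L[ℂ] Lp ℂ 2 μ) (φ Φ : Lp ℂ 2 (μ.prod ν)) : Prop :=
  ActsOnSlices ν A (fun z => φ z.swap) fun z => Φ z.swap

theorem eLpNorm_sub_le_of_norm_sub_le {φ ψ : Lp ℂ 2 μ} {n : ℕ} (h : ‖φ - ψ‖ ≤ 2⁻¹ ^ n) :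
    eLpNorm (⇑φ - ⇑ψ) 2 μ ≤ 2⁻¹ ^ n := by
  rw [← eLpNorm_congr_ae (Lp.coeFn_sub φ ψ), ← Lp.enorm_def, ← ofReal_norm]
  refine (ENNReal.ofReal_le_ofReal h).trans_eq ?_
  rw [ENNReal.ofReal_pow (by norm_num), ENNReal.ofReal_inv_of_pos (by norm_num)]
  simp

variable {A : Lp ℂ 2 μ →L[ℂ] Lp ℂ 2 μ} {B : Lp ℂ 2 ν →L[ℂ] Lp ℂ 2 ν}
  {φ Φ ψ Ψ : Lp ℂ 2 (μ.prod ν)} [SFinite ν]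

theorem ActsOnSnd.zero : ActsOnSnd B (0 : Lp ℂ 2 (μ.prod ν)) 0 :=
  ActsOnSlices.zero.congr (Lp.coeFn_zero _ _ _).symm (Lp.coeFn_zero _ _ _).symm

theorem ActsOnSnd.add (h : ActsOnSnd B φ Φ) (h' : ActsOnSnd B ψ Ψ) :
    ActsOnSnd B (φ + ψ) (Φ + Ψ) :=
  (ActsOnSlices.add h h').congr (Lp.coeFn_add _ _).symm (Lp.coeFn_add _ _).symm

theorem ActsOnSnd.smul (c : ℂ) (h : ActsOnSnd B φ Φ) : ActsOnSnd B (c • φ) (c • Φ) :=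
  (ActsOnSlices.smul c h).congr (Lp.coeFn_smul _ _).symm (Lp.coeFn_smul _ _).symm

theorem ActsOnSnd.of_limit {φs Φs : ℕ → Lp ℂ 2 (μ.prod ν)} (h : ∀ n, ActsOnSnd B (φs n) (Φs n))
    (hφ : ∀ n, ‖φs n - φ‖ ≤ 2⁻¹ ^ n) (hΦ : ∀ n, ‖Φs n - Φ‖ ≤ 2⁻¹ ^ n) : ActsOnSnd B φ Φ :=
  ActsOnSlices.of_limit h (Lp.stronglyMeasurable _).measurable
    (Lp.stronglyMeasurable _).measurable (fun _ => (Lp.stronglyMeasurable _).measurable)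
    (fun _ => (Lp.stronglyMeasurable _).measurable) (Lp.eLpNorm_ne_top _) (Lp.eLpNorm_ne_top _)
    (fun n => eLpNorm_sub_le_of_norm_sub_le (hφ n)) fun n => eLpNorm_sub_le_of_norm_sub_le (hΦ n)

variable [SFinite μ]

theorem eLpNorm_comp_swap {φ : M × N → ℂ} (hφ : Measurable φ) (p : ℝ≥0∞) :
    eLpNorm (fun z => φ (Prod.swap z)) p (ν.prod μ) = eLpNorm φ p (μ.prod ν) :=
  eLpNorm_comp_measurePreserving hφ.aestronglyMeasurable Measure.measurePreserving_swap

theorem swap_ae_eq {φ ψ : M × N → ℂ} (h : φ =ᵐ[μ.prod ν] ψ) :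
    (fun z => φ (Prod.swap z)) =ᵐ[ν.prod μ] fun z => ψ (Prod.swap z) :=
  Measure.measurePreserving_swap.quasiMeasurePreserving.ae h

theorem ActsOnFst.zero : ActsOnFst A (0 : Lp ℂ 2 (μ.prod ν)) 0 :=
  ActsOnSlices.zero.congr (swap_ae_eq (Lp.coeFn_zero _ _ _).symm)
    (swap_ae_eq (Lp.coeFn_zero _ _ _).symm)

theorem ActsOnFst.add (h : ActsOnFst A φ Φ) (h' : ActsOnFst A ψ Ψ) :
    ActsOnFst A (φ + ψ) (Φ + Ψ) :=
  (ActsOnSlices.add h h').congr (swap_ae_eq (Lp.coeFn_add _ _).symm)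
    (swap_ae_eq (Lp.coeFn_add _ _).symm)

theorem ActsOnFst.smul (c : ℂ) (h : ActsOnFst A φ Φ) : ActsOnFst A (c • φ) (c • Φ) :=
  (ActsOnSlices.smul c h).congr (swap_ae_eq (Lp.coeFn_smul _ _).symm)
    (swap_ae_eq (Lp.coeFn_smul _ _).symm)

theorem actsOnSnd_tensorLp (f : Lp ℂ 2 μ) (g : Lp ℂ 2 ν) :
    ActsOnSnd B (tensorLp μ ν f g) (tensorLp μ ν f (B g)) :=
  (ActsOnSlices.tensor f g).congr (coeFn_tensorLp _ _).symm (coeFn_tensorLp _ _).symm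

theorem actsOnFst_tensorLp (f : Lp ℂ 2 μ) (g : Lp ℂ 2 ν) :
    ActsOnFst A (tensorLp μ ν f g) (tensorLp μ ν (A f) g) := by
  refine (ActsOnSlices.tensor (μ := ν) (B := A) g f).congr ?_ ?_
  · filter_upwards [swap_ae_eq (coeFn_tensorLp (μ := μ) (ν := ν) f g)] with z hz
    rw [hz, mul_comm, Prod.fst_swap, Prod.snd_swap]
  · filter_upwards [swap_ae_eq (coeFn_tensorLp (μ := μ) (ν := ν) (A f) g)] with z hz
    rw [hz, mul_comm, Prod.fst_swap, Prod.snd_swap]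

theorem ActsOnSnd.norm_eq (h : ActsOnSnd B φ Φ) (hB : ∀ u, ‖B u‖ = ‖u‖) : ‖Φ‖ = ‖φ‖ := by
  rw [Lp.norm_def, Lp.norm_def, ActsOnSlices.eLpNorm_eq h hB
    (Lp.stronglyMeasurable φ).measurable (Lp.stronglyMeasurable Φ).measurable]

theorem ActsOnFst.norm_eq (h : ActsOnFst A φ Φ) (hA : ∀ u, ‖A u‖ = ‖u‖) : ‖Φ‖ = ‖φ‖ := by
  have hφ := (Lp.stronglyMeasurable φ).measurable
  have hΦ := (Lp.stronglyMeasurable Φ).measurable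
  have h1 := ActsOnSlices.eLpNorm_eq h hA (hφ.comp measurable_swap) (hΦ.comp measurable_swap)
  rw [eLpNorm_comp_swap hφ, eLpNorm_comp_swap hΦ] at h1
  rw [Lp.norm_def, Lp.norm_def, h1]

theorem ActsOnFst.of_limit {φs Φs : ℕ → Lp ℂ 2 (μ.prod ν)} (h : ∀ n, ActsOnFst A (φs n) (Φs n))
    (hφ : ∀ n, ‖φs n - φ‖ ≤ 2⁻¹ ^ n) (hΦ : ∀ n, ‖Φs n - Φ‖ ≤ 2⁻¹ ^ n) : ActsOnFst A φ Φ := by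
  have hm : ∀ u : Lp ℂ 2 (μ.prod ν), Measurable u := fun u => (Lp.stronglyMeasurable u).measurable
  have hfin : ∀ u : Lp ℂ 2 (μ.prod ν), eLpNorm (fun z => u (Prod.swap z)) 2 (ν.prod μ) ≠ ∞ := by
    intro u
    rw [eLpNorm_comp_swap (hm u)]
    exact Lp.eLpNorm_ne_top u
  have hsub : ∀ {u v : Lp ℂ 2 (μ.prod ν)} {n : ℕ}, ‖u - v‖ ≤ 2⁻¹ ^ n →
      eLpNorm ((fun z => u (Prod.swap z)) - fun z => v (Prod.swap z)) 2 (ν.prod μ) ≤ 2⁻¹ ^ n := by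
    intro u v n huv
    refine le_of_eq_of_le ?_ (eLpNorm_sub_le_of_norm_sub_le huv)
    exact eLpNorm_comp_swap ((hm u).sub (hm v)) 2
  exact ActsOnSlices.of_limit h ((hm _).comp measurable_swap) ((hm _).comp measurable_swap)
    (fun _ => (hm _).comp measurable_swap) (fun _ => (hm _).comp measurable_swap) (hfin _) (hfin _)
    (fun n => hsub (hφ n)) fun n => hsub (hΦ n)

end Factorization

section FactorizationExists

variable {M N : Type*} [MeasurableSpace M] [MeasurableSpace N] {μ : Measure M} {ν : Measure N}
  [SigmaFinite μ] [SigmaFinite ν]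

/-- If `S (f ⊗ g) = A f ⊗ B g` with isometries `A` and `B`, then `S` is `B` acting in the second
variable followed by `A` acting in the first one. The closed span of the triples
`(f ⊗ g, f ⊗ B g, A f ⊗ B g)` consists of triples `(φ, Φ, S φ)` related in this way, whose members
have equal norms. Its projection to the first component is thus isometric, so has closed range,
and the range contains the dense span of the tensors. -/
theorem exists_actsOnSnd_actsOnFst {A : Lp ℂ 2 μ →L[ℂ] Lp ℂ 2 μ} {B : Lp ℂ 2 ν →L[ℂ] Lp ℂ 2 ν}
    (hA : ∀ u, ‖A u‖ = ‖u‖) (hB : ∀ u, ‖B u‖ = ‖u‖)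
    {S : Lp ℂ 2 (μ.prod ν) →L[ℂ] Lp ℂ 2 (μ.prod ν)}
    (hS : ∀ f g, S (tensorLp μ ν f g) = tensorLp μ ν (A f) (B g)) (φ : Lp ℂ 2 (μ.prod ν)) :
    ∃ Φ : Lp ℂ 2 (μ.prod ν), ActsOnSnd B φ Φ ∧ ActsOnFst A Φ (S φ) := by
  let E := Lp ℂ 2 (μ.prod ν)
  let V : Submodule ℂ (E × E × E) := Submodule.span ℂ (Set.range fun p : Lp ℂ 2 μ × Lp ℂ 2 ν =>
    (tensorLp μ ν p.1 p.2, tensorLp μ ν p.1 (B p.2), tensorLp μ ν (A p.1) (B p.2)))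
  have hV : ∀ v ∈ V, ActsOnSnd B v.1 v.2.1 ∧ ActsOnFst A v.2.1 v.2.2 ∧ v.2.2 = S v.1 := by
    intro v hv
    induction hv using Submodule.span_induction with
    | mem v hv =>
      obtain ⟨⟨f, g⟩, rfl⟩ := hv
      exact ⟨actsOnSnd_tensorLp f g, actsOnFst_tensorLp f (B g), (hS f g).symm⟩
    | zero => exact ⟨ActsOnSnd.zero, ActsOnFst.zero, (map_zero S).symm⟩
    | add v w _ _ h h' =>
      refine ⟨h.1.add h'.1, h.2.1.add h'.2.1, ?_⟩
      rw [Prod.snd_add, Prod.snd_add, h.2.2, h'.2.2, Prod.fst_add, map_add]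
    | smul c v _ h =>
      refine ⟨h.1.smul c, h.2.1.smul c, ?_⟩
      rw [Prod.smul_snd, Prod.smul_snd, h.2.2, Prod.smul_fst, map_smul]
  have hcl : ∀ v ∈ V.topologicalClosure,
      ActsOnSnd B v.1 v.2.1 ∧ ActsOnFst A v.2.1 v.2.2 ∧ v.2.2 = S v.1 := by
    intro v hv
    have hex : ∀ n : ℕ, ∃ w ∈ V, ‖w - v‖ ≤ 2⁻¹ ^ n := by
      intro n
      obtain ⟨w, hw, hvw⟩ := Metric.mem_closure_iff.1 hv (2⁻¹ ^ n) (by positivity)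
      rw [dist_comm, dist_eq_norm] at hvw
      exact ⟨w, hw, hvw.le⟩
    choose w hw hwv using hex
    have h1 : ∀ n, ‖(w n).1 - v.1‖ ≤ 2⁻¹ ^ n := fun n => (norm_fst_le (w n - v)).trans (hwv n)
    have h2 : ∀ n, ‖(w n).2.1 - v.2.1‖ ≤ 2⁻¹ ^ n := fun n =>
      (norm_fst_le (w n - v).2).trans ((norm_snd_le (w n - v)).trans (hwv n))
    have h3 : ∀ n, ‖(w n).2.2 - v.2.2‖ ≤ 2⁻¹ ^ n := fun n =>
      (norm_snd_le (w n - v).2).trans ((norm_snd_le (w n - v)).trans (hwv n))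
    refine ⟨ActsOnSnd.of_limit (fun n => (hV _ (hw n)).1) h1 h2,
      ActsOnFst.of_limit (fun n => (hV _ (hw n)).2.1) h2 h3, ?_⟩
    have hclosed : _root_.IsClosed {v : E × E × E | v.2.2 = S v.1} :=
      isClosed_eq (by fun_prop) (by fun_prop)
    exact closure_minimal (fun w hw => (hV w hw).2.2) hclosed hv
  have hcomplete : CompleteSpace V.topologicalClosure :=
    V.isClosed_topologicalClosure.completeSpace_coe
  let P : V.topologicalClosure →ₗᵢ[ℂ] E :=
    { toLinearMap := LinearMap.fst ℂ E (E × E) ∘ₗ V.topologicalClosure.subtype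
      norm_map' := by
        rintro ⟨v, hv⟩
        obtain ⟨h1, h2, -⟩ := hcl v hv
        change ‖v.1‖ = max ‖v.1‖ (max ‖v.2.1‖ ‖v.2.2‖)
        rw [h2.norm_eq hA, h1.norm_eq hB, max_self, max_self] }
  have hrange : LinearMap.range P.toLinearMap = ⊤ := by
    have hclosed : _root_.IsClosed (LinearMap.range P.toLinearMap : Set E) :=
      P.isometry.isClosedEmbedding.isClosed_range
    rw [eq_top_iff, ← span_tensorLp_dense]
    refine Submodule.topologicalClosure_minimal _ (Submodule.span_le.2 ?_) hclosed
    rintro _ ⟨p, rfl⟩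
    exact ⟨⟨_, V.le_topologicalClosure (Submodule.subset_span ⟨p, rfl⟩)⟩, rfl⟩
  obtain ⟨⟨v, hv⟩, hvφ⟩ := LinearMap.range_eq_top.1 hrange φ
  have hvφ' : v.1 = φ := hvφ
  obtain ⟨h1, h2, h3⟩ := hcl v hv
  rw [h3] at h2
  rw [hvφ'] at h1 h2
  exact ⟨v.2.1, h1, h2⟩

end FactorizationExists

/-! ### The dispersive estimate -/

section Dispersive

variable {M N : Type*} [MeasurableSpace M] [MeasurableSpace N] {μ : Measure M} {ν : Measure N}
  [SigmaFinite μ] [SigmaFinite ν]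

/-- Since `p ≤ r`, Minkowski's inequality allows the bound for `B` to be applied in the second
variable after the bound for `A` has been applied in the first one. -/
theorem eLpNorm_le_of_actsOnSnd_actsOnFst {A : Lp ℂ 2 μ →L[ℂ] Lp ℂ 2 μ}
    {B : Lp ℂ 2 ν →L[ℂ] Lp ℂ 2 ν} {φ Φ Ψ : Lp ℂ 2 (μ.prod ν)} (h1 : ActsOnSnd B φ Φ)
    (h2 : ActsOnFst A Φ Ψ) {c d p r : ℝ≥0∞} (hp : p ≠ 0) (hpr : p ≤ r)
    (hA : ∀ u : Lp ℂ 2 μ, eLpNorm (A u) r μ ≤ c * eLpNorm u p μ)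
    (hB : ∀ u : Lp ℂ 2 ν, eLpNorm (B u) r ν ≤ d * eLpNorm u p ν) :
    eLpNorm Ψ r (μ.prod ν) ≤ c * d * eLpNorm φ p (μ.prod ν) := by
  have hm : ∀ u : Lp ℂ 2 (μ.prod ν), Measurable u := fun u => (Lp.stronglyMeasurable u).measurable
  have hmink := eLpNorm_eLpNorm_swap_le (μ := μ) (ν := ν) (hm Φ).enorm hp hpr
  simp only [eLpNorm_enorm (fun x => Φ (x, _)), eLpNorm_enorm (fun y => Φ (_, y))] at hmink
  have hm1 : Measurable fun y => eLpNorm (fun x => Φ (x, y)) p μ :=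
    measurable_eLpNorm_slice_complex ((hm Φ).comp measurable_swap) p
  calc eLpNorm Ψ r (μ.prod ν)
      = eLpNorm (fun y => eLpNorm (fun x => Ψ (x, y)) r μ) r ν := by
        exact (eLpNorm_comp_swap (hm Ψ) r).symm.trans
          (eLpNorm_prod_eq_slices ((hm Ψ).comp measurable_swap) r)
    _ ≤ eLpNorm (fun y => c * eLpNorm (fun x => Φ (x, y)) p μ) r ν :=
        eLpNorm_mono_enorm_ae (ActsOnSlices.ae_eLpNorm_le h2 hA)
    _ = c * eLpNorm (fun y => eLpNorm (fun x => Φ (x, y)) p μ) r ν := by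
        rw [eLpNorm_const_mul hm1]
    _ ≤ c * eLpNorm (fun x => eLpNorm (fun y => Φ (x, y)) r ν) p μ := by gcongr
    _ ≤ c * eLpNorm (fun x => d * eLpNorm (fun y => φ (x, y)) p ν) p μ := by
        gcongr c * ?_
        exact eLpNorm_mono_enorm_ae (ActsOnSlices.ae_eLpNorm_le h1 hB)
    _ = c * d * eLpNorm φ p (μ.prod ν) := by
        rw [eLpNorm_prod_eq_slices (hm φ), mul_assoc,
          eLpNorm_const_mul (measurable_eLpNorm_slice_complex (hm φ) p)]

/-- For `a = 0` the factor is `1`, and for `a > 0` it is nonzero as `|t| < ∞`. -/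
theorem ofReal_abs_rpow_neg_ne_zero (t a : ℝ) (ha : 0 ≤ a) : ENNReal.ofReal |t| ^ (-a) ≠ 0 := by
  rw [Ne, ENNReal.rpow_eq_zero_iff]
  rintro (⟨-, h⟩ | ⟨h, -⟩)
  · linarith
  · exact ENNReal.ofReal_ne_top h

theorem ofReal_abs_rpow_neg_add (t a b : ℝ) (ha : 0 ≤ a) (hb : 0 ≤ b) :
    ENNReal.ofReal |t| ^ (-(a + b)) = ENNReal.ofReal |t| ^ (-a) * ENNReal.ofReal |t| ^ (-b) := by
  rw [ENNReal.rpow_neg, ENNReal.rpow_add_of_nonneg _ _ ha hb, ENNReal.rpow_neg, ENNReal.rpow_neg,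
    ENNReal.mul_inv]
  · exact Or.inr (ENNReal.rpow_ne_top_of_nonneg hb ENNReal.ofReal_ne_top)
  · exact Or.inl (ENNReal.rpow_ne_top_of_nonneg ha ENNReal.ofReal_ne_top)

/-- For nonzero `c`, a bound of the `L^r` norm by `c` times the `L^p` norm on `L^2 ∩ L^p` holds on
all of `L^2`, the right-hand side being infinite outside `L^p`. -/
theorem eLpNorm_le_of_forall_memLp {α : Type*} [MeasurableSpace α] {κ : Measure α}
    {A : Lp ℂ 2 κ →L[ℂ] Lp ℂ 2 κ} {c p r : ℝ≥0∞} (hc : c ≠ 0)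
    (hA : ∀ u : Lp ℂ 2 κ, MemLp u p κ → eLpNorm (A u) r κ ≤ c * eLpNorm u p κ) (u : Lp ℂ 2 κ) :
    eLpNorm (A u) r κ ≤ c * eLpNorm u p κ := by
  by_cases hu : eLpNorm u p κ = ∞
  · rw [hu, ENNReal.mul_top hc]
    exact le_top
  · exact hA u ⟨Lp.aestronglyMeasurable u, lt_top_iff_ne_top.2 hu⟩

end Dispersive

theorem theorem1 {M N : Type*} [MeasurableSpace M] [MeasurableSpace N]
    (μ : Measure M) (ν : Measure N) [SigmaFinite μ] [SigmaFinite ν]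
    (H : Lp ℂ 2 μ →ₗ.[ℂ] Lp ℂ 2 μ) (K : Lp ℂ 2 ν →ₗ.[ℂ] Lp ℂ 2 ν)
    (L : Lp ℂ 2 (μ.prod ν) →ₗ.[ℂ] Lp ℂ 2 (μ.prod ν))
    (hH : IsSelfAdjoint H) (hK : IsSelfAdjoint K) (hL : IsSelfAdjoint L)
    (hsum : IsSumOperator H K L)
    (a b : ℝ) (ha : 0 ≤ a) (hb : 0 ≤ b)
    (I : Set ℝ) (hI : I.OrdConnected)
    (r' r : ℝ≥0∞) (hr' : 1 ≤ r') (hr : r' ≤ r)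
    (hdispH : DispersiveEstimate μ (schrodingerGroup H hH) I a r' r)
    (hdispK : DispersiveEstimate ν (schrodingerGroup K hK) I b r' r) :
    DispersiveEstimate (μ.prod ν) (schrodingerGroup L hL) I (a + b) r' r := by
  obtain ⟨C₁, hC₁, h₁⟩ := hdispH
  obtain ⟨C₂, hC₂, h₂⟩ := hdispK
  refine ⟨C₁ * C₂, mul_pos hC₁ hC₂, fun t ht φ _ => ?_⟩
  have hU := schrodingerGroup_spec hH
  have hV := schrodingerGroup_spec hK
  obtain ⟨Φ, hΦ₁, hΦ₂⟩ := exists_actsOnSnd_actsOnFst (hU.norm_map t) (hV.norm_map t)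
    (hsum.group_tensorLp hH hK hL hU hV (schrodingerGroup_spec hL) t) φ
  have hc₁ : (C₁ : ℝ≥0∞) * ENNReal.ofReal |t| ^ (-a) ≠ 0 :=
    mul_ne_zero (by exact_mod_cast hC₁.ne') (ofReal_abs_rpow_neg_ne_zero t a ha)
  have hc₂ : (C₂ : ℝ≥0∞) * ENNReal.ofReal |t| ^ (-b) ≠ 0 :=
    mul_ne_zero (by exact_mod_cast hC₂.ne') (ofReal_abs_rpow_neg_ne_zero t b hb)
  refine (eLpNorm_le_of_actsOnSnd_actsOnFst hΦ₁ hΦ₂ (zero_lt_one.trans_le hr').ne' hr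
    (eLpNorm_le_of_forall_memLp hc₁ (h₁ t ht))
    (eLpNorm_le_of_forall_memLp hc₂ (h₂ t ht))).trans_eq ?_
  rw [ofReal_abs_rpow_neg_add t a b ha hb, ENNReal.coe_mul, mul_mul_mul_comm]
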